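/- **Setting.** Let $\mathbf u=2^{-53}$. For a real matrix, $\|\cdot\|_2$ and $\|\cdot\|_F$ are the spectral and Frobenius norms. For $X\in\mathbb R^{m\times n}$ with columns $X_1,\dots,X_n$ put $\|X\|_g=\sqrt n\,\max_{1\le j\le n}\|X_j\|_2$. If $X$ has full column rank, put $\kappa_2(X)=\|X\|_2/\sigma_n(X)$, where $\sigma_n(X)$ is the $n$-th greatest singular value of $X$, and $j=\|X\|_g/\|X\|_2$. *Sketching.* A matrix $\Omega\in\mathbb R^{s\times m}$ is an $\epsilon$-subspace embedding ($0\le\epsilon<1$) for a subspace $\mathcal K\subset\mathbb R^m$ if $|\langle x,y\rangle-\langle\Omega x,\Omega y\rangle|\le\epsilon\|x\|_2\|y\|_2$ for all $x,y\in\mathcal K$. A random matrix $\Omega$ is an $(\epsilon,p,n)$ oblivious $\ell_2$-subspace embedding if, for each fixed $n$-dimensional subspace $\mathcal K\subset\mathbb R^m$, it is an $\epsilon$-subspace embedding for $\mathcal K$ with probability at least $1-p$. *Algorithm.* $[Q,R]=\mathrm{SRCholeskyQR2}(X)$ is: $A=\Omega X$, $G=A^\top A$, $Y=\mathrm{Cholesky}(G)$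 (upper triangular), $W=XY^{-1}$; $C=W^\top W$, $Z=\mathrm{Cholesky}(C)$, $Q=WZ^{-1}$; $R=ZY$. All steps are carried out in floating-point arithmetic under the standard model: each addition, subtraction, multiplication, division and square root returns its exact result times $1+\delta$ with some $|\delta|\le\mathbf u$ (no overflow or underflow), sums are evaluated in any order, matrix products are computed entrywise as inner products, and $XY^{-1}$, $WZ^{-1}$ are computed row by row by substitution. A Cholesky factorization breaks down if a computed pivot is not positive. **Theorem.** Let $1\le n\le s\le m$ with $m\ge gn$ for some $g\ge1$, let $X\in\mathbb R^{m\times n}$ (sparse or not) have rank $n$, let $0\le\epsilon<1$, and let $\Omega\in\mathbb R^{s\times m}$ be a random matrix that is an $(\epsilon,p,n)$ oblivious $\ell_2$-subspace embedding. Assume $$mn\mathbf u\le\tfrac1{64},\qquad n(n+1)\mathbf u\le\tfrac1{64},\qquad \frac{\sqrt{1-\epsilon}}{\sqrt{1+\epsilon}}\ge\frac{32}{3}\sqrt{mn\mathbf u+n(n+1)\mathbf u}+\frac{2}{87}.$$ Put $t_1=1.1\,m\mathbf u\,\sqrt s\,\|\Omega\|_2$, $$w_1=\min\Bigl(\frac{\sqrt{1-\epsilon}}{10.5\,j\,t_1},\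 \frac{1}{10.5\,j\,(\sqrt{1+\epsilon}+t_1)}\sqrt{\frac{1-\epsilon}{s\mathbf u+(n+1)\mathbf u}}\Bigr),$$ $$b=\frac{1.16}{0.87\sqrt{\frac{1-\epsilon}{1+\epsilon}}-0.02},\qquad h=5b^2\,(mn\mathbf u+n(n+1)\mathbf u),$$ $$U_4=\frac{1.32+1.34\sqrt{1+h}}{\sqrt{1-\epsilon}}(\sqrt{1+\epsilon}+t_1)\,jn\sqrt n\,\mathbf u\|X\|_2+\frac{1.34\sqrt{1+h}}{\sqrt{1-\epsilon}}(\sqrt{1+\epsilon}+t_1j)\,n^2\mathbf u\|X\|_2.$$ Then, with probability at least $1-p$ over $\Omega$, the following holds: if $\kappa_2(X)\le w_1$ (a condition on $\Omega$ through $t_1$), then $\mathrm{SRCholeskyQR2}(X)$ runs to completion without breakdown, whatever the rounding errors, and its computed factors $Q,R$ satisfy $$\|Q^\top Q-I_n\|_F\le5b^2\,(mn\mathbf u+n(n+1)\mathbf u),\qquad \|QR-X\|_F\le U_4 .$$ -/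

import Mathlib

open MeasureTheory

namespace RandCholQR

noncomputable section

/-! ### Norms and the condition number -/

/-- The spectral norm `‖A‖₂`: operator norm between Euclidean spaces. -/
def norm2 {a b : ℕ} (A : Matrix (Fin a) (Fin b) ℝ) : ℝ :=
  ‖LinearMap.toContinuousLinearMap (Matrix.toEuclideanLin A)‖

/-- The Frobenius norm `‖A‖_F`. -/
def normF {a b : ℕ} (A : Matrix (Fin a) (Fin b) ℝ) : ℝ :=
  √(∑ i, ∑ j, A i j ^ 2)

/-- `[A]_g`, the largest Euclidean norm of a column of `A`. -/
def maxColNorm {a b : ℕ} (A : Matrix (Fin a) (Fin b) ℝ) : ℝ :=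
  ⨆ j : Fin b, √(∑ i, A i j ^ 2)

/-- `‖A‖_g = √b * [A]_g`, where `b` is the number of columns. -/
def normG {a b : ℕ} (A : Matrix (Fin a) (Fin b) ℝ) : ℝ :=
  √(b : ℝ) * maxColNorm A

/-- `σ_b(A)`, the `b`-th greatest singular value of a matrix with `b` columns
(Mathlib counts the singular values from `0`). -/
def sigmaMin {a b : ℕ} (A : Matrix (Fin a) (Fin b) ℝ) : ℝ :=
  (Matrix.toEuclideanLin A).singularValues (b - 1)

/-- The condition number `κ₂(A) = ‖A‖₂ / σ_b(A)` (for `A` of full column rank). -/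
def cond2 {a b : ℕ} (A : Matrix (Fin a) (Fin b) ℝ) : ℝ :=
  norm2 A / sigmaMin A

/-! ### Floating-point arithmetic (standard model) -/

/-- The machine precision of double precision. -/
def u : ℝ := 2⁻¹ ^ 53

/-- `y` is an admissible computed value of a single operation with exact result `x`:
`y = x (1 + δ)` with `|δ| ≤ u`. -/
def FlRound (x y : ℝ) : Prop := ∃ δ : ℝ, |δ| ≤ u ∧ y = x * (1 + δ)

/-- `FlSum s r`: `r` is a possible computed value of the sum of the terms `s`, where the terms are
added two at a time, in any order and with any bracketing, each addition being rounded. -/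
inductive FlSum : Multiset ℝ → ℝ → Prop
  | single (x : ℝ) : FlSum {x} x
  | add {s t : Multiset ℝ} {a b c : ℝ} :
      FlSum s a → FlSum t b → FlRound (a + b) c → FlSum (s + t) c

/-- `r` is a possible computed value of `∑ k, x k * y k`. -/
def FlDot {l : ℕ} (x y : Fin l → ℝ) (r : ℝ) : Prop :=
  ∃ q : Fin l → ℝ, (∀ k, FlRound (x k * y k) (q k)) ∧ FlSum (Finset.univ.val.map q) r

/-- `r` is a possible computed value of `c - ∑ k < i, x k * y k`. -/
def FlSubDot {l : ℕ} (c : ℝ) (i : Fin l) (x y : Fin l → ℝ) (r : ℝ) : Prop :=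
  ∃ q : Fin l → ℝ, (∀ k, k < i → FlRound (x k * y k) (q k)) ∧
    FlSum (c ::ₘ (Finset.Iio i).val.map (fun k => -q k)) r

/-- `C` is a possible computed value of the matrix product `A * B`. -/
def FlMul {a l b : ℕ} (A : Matrix (Fin a) (Fin l) ℝ) (B : Matrix (Fin l) (Fin b) ℝ)
    (C : Matrix (Fin a) (Fin b) ℝ) : Prop :=
  ∀ i j, FlDot (fun k => A i k) (fun k => B k j) (C i j)

/-- The first `r` rows of `Y` are possible computed rows of the upper triangular Cholesky factor
of `G` (of which only the upper triangle is read); all pivots met so far are positive. -/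
def FlCholeskyRows {n : ℕ} (G Y : Matrix (Fin n) (Fin n) ℝ) (r : ℕ) : Prop :=
  ∀ i : Fin n, (i : ℕ) < r →
    (∃ c, FlSubDot (G i i) i (fun k => Y k i) (fun k => Y k i) c ∧ 0 < c ∧
      FlRound (√c) (Y i i)) ∧
    (∀ j, i < j → ∃ c, FlSubDot (G i j) i (fun k => Y k i) (fun k => Y k j) c ∧
      FlRound (c / Y i i) (Y i j)) ∧
    (∀ j, j < i → Y i j = 0)

/-- `Y` is a possible computed Cholesky factor of `G` (the factorization runs to completion). -/
def FlCholesky {n : ℕ} (G Y : Matrix (Fin n) (Fin n) ℝ) : Prop :=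
  FlCholeskyRows G Y n

/-- The computed Cholesky factorization of `G` may break down: after some possible computation of
the first rows, a computed pivot is not positive. -/
def CholeskyMayBreakDown {n : ℕ} (G : Matrix (Fin n) (Fin n) ℝ) : Prop :=
  ∃ (Y : Matrix (Fin n) (Fin n) ℝ) (i : Fin n) (c : ℝ), FlCholeskyRows G Y i ∧
    FlSubDot (G i i) i (fun k => Y k i) (fun k => Y k i) c ∧ c ≤ 0

/-- `W` is a possible computed value of `X * Y⁻¹` for upper triangular `Y`, each row `w` of `W`
being obtained by substitution in `w Y = x`. -/
def FlTriSolve {m n : ℕ} (X : Matrix (Fin m) (Fin n) ℝ) (Y : Matrix (Fin n) (Fin n) ℝ)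
    (W : Matrix (Fin m) (Fin n) ℝ) : Prop :=
  ∀ i j, ∃ c, FlSubDot (X i j) j (fun k => W i k) (fun k => Y k j) c ∧
    FlRound (c / Y j j) (W i j)

/-! ### The algorithms in floating-point arithmetic -/

/-- `[Q, R]` is a possible computed result of CholeskyQR applied to `X`. -/
def FlCholeskyQR {m n : ℕ} (X Q : Matrix (Fin m) (Fin n) ℝ) (R : Matrix (Fin n) (Fin n) ℝ) :
    Prop :=
  ∃ G, FlMul X.transpose X G ∧ FlCholesky G R ∧ FlTriSolve X R Q

/-- `[W, Y]` is a possible computed result of the sketched first pass: `A = Ω X`, `G = Aᵀ A`,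
`Y = Cholesky(G)`, `W = X Y⁻¹`. -/
def FlSketchedCholeskyQR {s m n : ℕ} (Ω : Matrix (Fin s) (Fin m) ℝ)
    (X W : Matrix (Fin m) (Fin n) ℝ) (Y : Matrix (Fin n) (Fin n) ℝ) : Prop :=
  ∃ A G, FlMul Ω X A ∧ FlMul A.transpose A G ∧ FlCholesky G Y ∧ FlTriSolve X Y W

/-- `[Q, R]` is a possible computed result of SRCholeskyQR2 applied to `X` with sketch `Ω`. -/
def FlSRCholeskyQR2 {s m n : ℕ} (Ω : Matrix (Fin s) (Fin m) ℝ)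
    (X Q : Matrix (Fin m) (Fin n) ℝ) (R : Matrix (Fin n) (Fin n) ℝ) : Prop :=
  ∃ W Y Z, FlSketchedCholeskyQR Ω X W Y ∧ FlCholeskyQR W Q Z ∧ FlMul Z Y R

/-- In some possible computation of SRCholeskyQR2, one of the two Cholesky factorizations
breaks down. -/
def SRCholeskyQR2MayBreakDown {s m n : ℕ} (Ω : Matrix (Fin s) (Fin m) ℝ)
    (X : Matrix (Fin m) (Fin n) ℝ) : Prop :=
  (∃ A G, FlMul Ω X A ∧ FlMul A.transpose A G ∧ CholeskyMayBreakDown G) ∨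
  (∃ W Y C, FlSketchedCholeskyQR Ω X W Y ∧ FlMul W.transpose W C ∧ CholeskyMayBreakDown C)

/-! ### Random sketching -/

/-- The property `E` of the outcome holds with probability at least `q`: it holds on a measurable
event of probability at least `q`. -/
def HoldsWithProb {Θ : Type*} [MeasurableSpace Θ] (P : Measure Θ) (q : ℝ) (E : Θ → Prop) :
    Prop :=
  ∃ S : Set Θ, MeasurableSet S ∧ (∀ θ ∈ S, E θ) ∧ q ≤ P.real S

/-- `Ω` is an `ε`-subspace embedding for the subspace `K` of `ℝ^m`. -/
def IsSubspaceEmbedding {s m : ℕ} (ε : ℝ) (Ω : Matrix (Fin s) (Fin m) ℝ)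
    (K : Submodule ℝ (EuclideanSpace ℝ (Fin m))) : Prop :=
  (0 ≤ ε ∧ ε < 1) ∧ ∀ x ∈ K, ∀ y ∈ K,
    |inner ℝ x y - inner ℝ (Matrix.toEuclideanLin Ω x) (Matrix.toEuclideanLin Ω y)|
      ≤ ε * ‖x‖ * ‖y‖

/-- The random matrix `Ω` is an `(ε, p, n)` oblivious `ℓ₂`-subspace embedding: for each fixed
`n`-dimensional subspace it is an `ε`-subspace embedding with probability at least `1 - p`. -/
def IsObliviousSubspaceEmbedding {Θ : Type*} [MeasurableSpace Θ] (P : Measure Θ) {s m : ℕ}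
    (Ω : Θ → Matrix (Fin s) (Fin m) ℝ) (ε p : ℝ) (n : ℕ) : Prop :=
  ∀ K : Submodule ℝ (EuclideanSpace ℝ (Fin m)), Module.finrank ℝ K = n →
    HoldsWithProb P (1 - p) (fun θ => IsSubspaceEmbedding ε (Ω θ) K)

/-! ### The quantities in the conditions and the bounds -/

/-- `j = ‖X‖_g / ‖X‖₂`. -/
def jRatio {m n : ℕ} (X : Matrix (Fin m) (Fin n) ℝ) : ℝ := normG X / norm2 X

/-- `t₁ = 1.1 m u √s ‖Ω‖₂`. -/
def t1 {s m : ℕ} (Ω : Matrix (Fin s) (Fin m) ℝ) : ℝ :=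
  1.1 * m * u * (√(s : ℝ) * norm2 Ω)

/-- The upper bound `w₁` on the condition number of `X`. -/
def w1 {s m n : ℕ} (ε : ℝ) (Ω : Matrix (Fin s) (Fin m) ℝ) (X : Matrix (Fin m) (Fin n) ℝ) : ℝ :=
  min (√(1 - ε) / (10.5 * jRatio X * t1 Ω))
    (1 / (10.5 * jRatio X * (√(1 + ε) + t1 Ω)) * √((1 - ε) / (s * u + (n + 1) * u)))

/-- `b = 1.16 / (0.87 √((1 - ε) / (1 + ε)) - 0.02)`. -/
def bConst (ε : ℝ) : ℝ := 1.16 / (0.87 * √((1 - ε) / (1 + ε)) - 0.02)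

/-- `h = 5 b² (m n u + n (n + 1) u)`, the bound on the loss of orthogonality. -/
def hConst (m n : ℕ) (ε : ℝ) : ℝ :=
  5 * bConst ε ^ 2 * (m * n * u + n * (n + 1) * u)

/-- The residual bound `U₄`. -/
def U4 {s m n : ℕ} (ε : ℝ) (Ω : Matrix (Fin s) (Fin m) ℝ) (X : Matrix (Fin m) (Fin n) ℝ) : ℝ :=
  (1.32 + 1.34 * √(1 + hConst m n ε)) / √(1 - ε) * (√(1 + ε) + t1 Ω) *
      (jRatio X * n * √(n : ℝ) * u * norm2 X) +
    1.34 * √(1 + hConst m n ε) / √(1 - ε) * (√(1 + ε) + t1 Ω * jRatio X) *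
      ((n : ℝ) ^ 2 * u * norm2 X)

end

end RandCholQR

open RandCholQR

/-! Randomness enters only once. The range of X is a fixed n-dimensional subspace, so Ω embeds it
with probability at least 1 - p, and on that event the statement is deterministic
(`srCholeskyQR2_of_isSubspaceEmbedding`). Put α = √(1-ε), β = √(1+ε) and η = mnu + n(n+1)u; then
‖ΩXx‖ lies between α‖Xx‖ and β‖Xx‖ for every x.

The condition κ₂(X) ≤ w₁ makes the errors of forming A ≈ ΩX and of factoring its Gram matrix small
against α σ_n(X). Hence the computed Y satisfies 0.89 α‖Xx‖ ≤ ‖Yx‖ ≤ 1.1 β‖Xx‖: it inherits any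
ill-conditioning of X, and dividing by it leaves a W with ‖W‖₂ ≤ 1.14/α and ‖Wx‖ ≥ ω‖x‖, ω = 0.87/β
- 0.02/α (`SketchBounds.norm2_solve_le`, `SketchBounds.norm_solve_ge`). Thus κ₂(W) ≤ b independently
of X. The second pass is CholeskyQR of a well-conditioned matrix; the hypothesis on ε yields b²η ≤
1/64 (`bConst_bounds`), which keeps its Gram error small relative to ω² and gives the orthogonality
bound.

Breakdown is excluded in both passes by `CholeskyMayBreakDown.exists_norm_sq_le`: a nonpositive
pivot yields a nonzero x with ‖Ax‖² at most a multiple of (s+n+1)u ‖A‖_F² ‖x‖², against the lower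
bound on ‖Ax‖.

The residual telescopes as QR - X = (WY - X) + (QZ - W)Y + Q(R - ZY). Each bracket is the backward
error of one step and no inverse occurs, so the bound is free of κ₂(X). -/

namespace RandCholQR

open Matrix

/-! ### Spectral, Frobenius and column norms; the smallest singular value. -/

section Norms

variable {a b c : ℕ}

lemma norm2_nonneg (A : Matrix (Fin a) (Fin b) ℝ) : 0 ≤ norm2 A := norm_nonneg _

lemma norm_toEuclideanLin_le (A : Matrix (Fin a) (Fin b) ℝ) (x : EuclideanSpace ℝ (Fin b)) :
    ‖toEuclideanLin A x‖ ≤ norm2 A * ‖x‖ :=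
  (LinearMap.toContinuousLinearMap (toEuclideanLin A)).le_opNorm x

lemma norm2_le (A : Matrix (Fin a) (Fin b) ℝ) {r : ℝ} (hr : 0 ≤ r)
    (h : ∀ x, ‖toEuclideanLin A x‖ ≤ r * ‖x‖) : norm2 A ≤ r :=
  ContinuousLinearMap.opNorm_le_bound _ hr h

lemma toEuclideanLin_mul (A : Matrix (Fin a) (Fin b) ℝ) (B : Matrix (Fin b) (Fin c) ℝ)
    (x : EuclideanSpace ℝ (Fin c)) :
    toEuclideanLin (A * B) x = toEuclideanLin A (toEuclideanLin B x) := by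
  ext i
  simp [toLpLin_apply, mulVec_mulVec]

lemma norm2_mul_le (A : Matrix (Fin a) (Fin b) ℝ) (B : Matrix (Fin b) (Fin c) ℝ) :
    norm2 (A * B) ≤ norm2 A * norm2 B := by
  refine norm2_le _ (mul_nonneg (norm2_nonneg _) (norm2_nonneg _)) fun x => ?_
  rw [toEuclideanLin_mul, mul_assoc]
  exact (norm_toEuclideanLin_le _ _).trans
    (mul_le_mul_of_nonneg_left (norm_toEuclideanLin_le _ _) (norm2_nonneg _))

lemma norm2_transpose (A : Matrix (Fin a) (Fin b) ℝ) : norm2 Aᵀ = norm2 A := by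
  have := l2_opNorm_conjTranspose A
  rwa [conjTranspose_eq_transpose_of_trivial] at this

lemma normF_nonneg (A : Matrix (Fin a) (Fin b) ℝ) : 0 ≤ normF A := Real.sqrt_nonneg _

lemma normF_sq (A : Matrix (Fin a) (Fin b) ℝ) : normF A ^ 2 = ∑ i, ∑ j, A i j ^ 2 :=
  Real.sq_sqrt (by positivity)

lemma normF_transpose (A : Matrix (Fin a) (Fin b) ℝ) : normF Aᵀ = normF A := by
  unfold normF
  rw [Finset.sum_comm]
  rfl

lemma normF_neg (A : Matrix (Fin a) (Fin b) ℝ) : normF (-A) = normF A := by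
  simp [normF]

lemma normF_sub_comm (A B : Matrix (Fin a) (Fin b) ℝ) : normF (A - B) = normF (B - A) := by
  rw [← normF_neg, neg_sub]

lemma normF_eq_norm (A : Matrix (Fin a) (Fin b) ℝ) :
    normF A = ‖(WithLp.toLp 2 (fun p : Fin a × Fin b => A p.1 p.2) :
      EuclideanSpace ℝ (Fin a × Fin b))‖ := by
  rw [EuclideanSpace.norm_eq, normF, Fintype.sum_prod_type]
  simp

lemma normF_add_le (A B : Matrix (Fin a) (Fin b) ℝ) : normF (A + B) ≤ normF A + normF B := by
  simp only [normF_eq_norm]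
  exact norm_add_le (WithLp.toLp 2 (fun p : Fin a × Fin b => A p.1 p.2) :
      EuclideanSpace ℝ (Fin a × Fin b)) (WithLp.toLp 2 (fun p : Fin a × Fin b => B p.1 p.2))

lemma normF_le_of_abs_le {A B : Matrix (Fin a) (Fin b) ℝ} (h : ∀ i j, |A i j| ≤ B i j) :
    normF A ≤ normF B := by
  refine Real.sqrt_le_sqrt (Finset.sum_le_sum fun i _ => Finset.sum_le_sum fun j _ => ?_)
  rw [← sq_abs]
  exact pow_le_pow_left₀ (abs_nonneg _) (h i j) 2

lemma normF_smul {r : ℝ} (hr : 0 ≤ r) (A : Matrix (Fin a) (Fin b) ℝ) :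
    normF (r • A) = r * normF A := by
  simp only [normF, Matrix.smul_apply, smul_eq_mul, mul_pow, ← Finset.mul_sum]
  rw [Real.sqrt_mul (sq_nonneg r), Real.sqrt_sq hr]

lemma normF_map_abs (A : Matrix (Fin a) (Fin b) ℝ) : normF (A.map abs) = normF A := by
  simp [normF]

/-- The Euclidean norm of the `j`-th column. -/
noncomputable def colNorm (A : Matrix (Fin a) (Fin b) ℝ) (j : Fin b) : ℝ := √(∑ i, A i j ^ 2)

lemma colNorm_nonneg (A : Matrix (Fin a) (Fin b) ℝ) (j : Fin b) : 0 ≤ colNorm A j :=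
  Real.sqrt_nonneg _

lemma colNorm_sq (A : Matrix (Fin a) (Fin b) ℝ) (j : Fin b) :
    colNorm A j ^ 2 = ∑ i, A i j ^ 2 := Real.sq_sqrt (by positivity)

lemma sum_colNorm_sq (A : Matrix (Fin a) (Fin b) ℝ) :
    ∑ j, colNorm A j ^ 2 = normF A ^ 2 := by
  rw [normF_sq, Finset.sum_comm]
  simp [colNorm_sq]

lemma colNorm_eq (A : Matrix (Fin a) (Fin b) ℝ) (j : Fin b) :
    colNorm A j = ‖toEuclideanLin A (EuclideanSpace.single j 1)‖ := by
  rw [EuclideanSpace.norm_eq, colNorm]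
  simp [toLpLin_apply]

lemma normF_le_of_colNorm_le {a' : ℕ} {A : Matrix (Fin a) (Fin b) ℝ}
    {B : Matrix (Fin a') (Fin b) ℝ} {r : ℝ} (hr : 0 ≤ r)
    (h : ∀ j, colNorm A j ≤ r * colNorm B j) : normF A ≤ r * normF B := by
  refine le_of_sq_le_sq ?_ (mul_nonneg hr (normF_nonneg _))
  rw [mul_pow, ← sum_colNorm_sq, ← sum_colNorm_sq, Finset.mul_sum]
  refine Finset.sum_le_sum fun j _ => ?_
  rw [← mul_pow]
  exact pow_le_pow_left₀ (colNorm_nonneg _ _) (h j) 2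

lemma normF_mul_le_norm2_mul (A : Matrix (Fin a) (Fin b) ℝ) (B : Matrix (Fin b) (Fin c) ℝ) :
    normF (A * B) ≤ norm2 A * normF B := by
  refine normF_le_of_colNorm_le (norm2_nonneg _) fun j => ?_
  rw [colNorm_eq, colNorm_eq, toEuclideanLin_mul]
  exact norm_toEuclideanLin_le _ _

lemma normF_mul_le_mul_norm2 (A : Matrix (Fin a) (Fin b) ℝ) (B : Matrix (Fin b) (Fin c) ℝ) :
    normF (A * B) ≤ normF A * norm2 B := by
  rw [← normF_transpose (A * B), transpose_mul, ← normF_transpose A, ← norm2_transpose B, mul_comm]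
  exact normF_mul_le_norm2_mul _ _

lemma norm2_le_normF (A : Matrix (Fin a) (Fin b) ℝ) : norm2 A ≤ normF A := by
  refine norm2_le _ (normF_nonneg _) fun x => ?_
  refine le_of_sq_le_sq ?_ (mul_nonneg (normF_nonneg _) (norm_nonneg _))
  rw [mul_pow, normF_sq, EuclideanSpace.norm_sq_eq, EuclideanSpace.norm_sq_eq, Finset.sum_mul]
  refine Finset.sum_le_sum fun i _ => ?_
  simp only [toLpLin_apply, Real.norm_eq_abs, sq_abs]
  exact Finset.sum_mul_sq_le_sq_mul_sq Finset.univ (fun j => A i j) (fun j => x j)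

lemma normF_le_sqrt_mul_norm2 (A : Matrix (Fin a) (Fin b) ℝ) : normF A ≤ √b * norm2 A := by
  refine le_of_sq_le_sq ?_ (mul_nonneg (Real.sqrt_nonneg _) (norm2_nonneg _))
  rw [mul_pow, Real.sq_sqrt (Nat.cast_nonneg _), ← sum_colNorm_sq]
  calc ∑ j, colNorm A j ^ 2 ≤ ∑ j : Fin b, norm2 A ^ 2 := by
        refine Finset.sum_le_sum fun j _ => pow_le_pow_left₀ (colNorm_nonneg _ _) ?_ 2
        rw [colNorm_eq]
        simpa using norm_toEuclideanLin_le A (EuclideanSpace.single j 1)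
    _ = b * norm2 A ^ 2 := by simp

lemma normF_mul_le (A : Matrix (Fin a) (Fin b) ℝ) (B : Matrix (Fin b) (Fin c) ℝ) :
    normF (A * B) ≤ normF A * normF B :=
  (normF_mul_le_norm2_mul A B).trans
    (mul_le_mul_of_nonneg_right (norm2_le_normF A) (normF_nonneg _))

/-- An entrywise bound by the product of the absolute values gives a Frobenius norm bound. -/
lemma normF_le_of_abs_le_sum {E : Matrix (Fin a) (Fin c) ℝ} {A : Matrix (Fin a) (Fin b) ℝ}
    {B : Matrix (Fin b) (Fin c) ℝ} {r : ℝ} (hr : 0 ≤ r)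
    (h : ∀ i j, |E i j| ≤ r * ∑ k, |A i k * B k j|) : normF E ≤ r * (normF A * normF B) := by
  have h1 : normF E ≤ normF (r • (A.map abs * B.map abs)) := by
    refine normF_le_of_abs_le fun i j => (h i j).trans_eq ?_
    simp [mul_apply, abs_mul]
  rw [normF_smul hr] at h1
  refine h1.trans (mul_le_mul_of_nonneg_left ?_ hr)
  simpa only [normF_map_abs] using normF_mul_le (A.map abs) (B.map abs)

/-- The double sum of ‖A_i‖²‖A_j‖² factors as ‖A‖_F⁴, so no power of the dimension is lost. -/
lemma normF_le_of_abs_le_colNorm {E : Matrix (Fin b) (Fin b) ℝ} {A : Matrix (Fin a) (Fin b) ℝ}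
    {r : ℝ} (hr : 0 ≤ r) (h : ∀ i j, |E i j| ≤ r * (colNorm A i * colNorm A j)) :
    normF E ≤ r * normF A ^ 2 := by
  refine le_of_sq_le_sq ?_ (mul_nonneg hr (sq_nonneg _))
  rw [normF_sq, mul_pow, ← sum_colNorm_sq, sq (∑ j, _), Finset.sum_mul_sum, Finset.mul_sum]
  refine Finset.sum_le_sum fun i _ => ?_
  rw [Finset.mul_sum]
  refine Finset.sum_le_sum fun j _ => ?_
  rw [← sq_abs, ← mul_pow, ← mul_pow]
  exact pow_le_pow_left₀ (abs_nonneg _) (h i j) 2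

lemma sum_abs_mul_colNorm_le (A : Matrix (Fin a) (Fin b) ℝ) (x : EuclideanSpace ℝ (Fin b)) :
    (∑ j, |x j| * colNorm A j) ^ 2 ≤ normF A ^ 2 * ‖x‖ ^ 2 := by
  refine (Finset.sum_mul_sq_le_sq_mul_sq _ _ _).trans_eq ?_
  rw [sum_colNorm_sq, EuclideanSpace.norm_sq_eq, mul_comm]
  simp

lemma norm_toEuclideanLin_sq (A : Matrix (Fin a) (Fin b) ℝ) (x : EuclideanSpace ℝ (Fin b)) :
    ‖toEuclideanLin A x‖ ^ 2 = inner ℝ x (toEuclideanLin (Aᵀ * A) x) := by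
  rw [← real_inner_self_eq_norm_sq, toEuclideanLin_mul, ← conjTranspose_eq_transpose_of_trivial,
    toEuclideanLin_conjTranspose_eq_adjoint, LinearMap.adjoint_inner_right]

/-- Perturbation of the Gram matrix changes the squared norms of images only slightly. -/
lemma abs_norm_sq_sub_le {a' : ℕ} (A : Matrix (Fin a) (Fin b) ℝ) (B : Matrix (Fin a') (Fin b) ℝ)
    (x : EuclideanSpace ℝ (Fin b)) :
    |‖toEuclideanLin B x‖ ^ 2 - ‖toEuclideanLin A x‖ ^ 2| ≤
      normF (Bᵀ * B - Aᵀ * A) * ‖x‖ ^ 2 := by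
  rw [norm_toEuclideanLin_sq, norm_toEuclideanLin_sq, ← inner_sub_right, ← LinearMap.sub_apply,
    ← map_sub]
  refine (abs_real_inner_le_norm _ _).trans ?_
  calc _ ≤ ‖x‖ * (normF (Bᵀ * B - Aᵀ * A) * ‖x‖) := by
        gcongr
        exact (norm_toEuclideanLin_le _ _).trans
          (mul_le_mul_of_nonneg_right (norm2_le_normF _) (norm_nonneg _))
    _ = _ := by ring

lemma finrank_range_toEuclideanLin (A : Matrix (Fin a) (Fin b) ℝ) :
    Module.finrank ℝ (toEuclideanLin A).range = A.rank := by
  rw [rank_eq_finrank_range_toLin A (EuclideanSpace.basisFun _ ℝ).toBasis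
    (EuclideanSpace.basisFun _ ℝ).toBasis, toEuclideanLin_eq_toLin_orthonormal]

lemma sigmaMin_pos (A : Matrix (Fin a) (Fin b) ℝ) (hb : 1 ≤ b) (hA : A.rank = b) :
    0 < sigmaMin A := by
  rw [sigmaMin, LinearMap.singularValues_pos_iff_lt_finrank_range, finrank_range_toEuclideanLin,
    hA]
  omega

/-- In an orthonormal eigenbasis of AᵀA, ‖Ax‖² is the sum of the squared coordinates of x weighted
by squared singular values, and the one of index `b - 1` is the least. -/
lemma sigmaMin_mul_norm_le (A : Matrix (Fin a) (Fin b) ℝ) (hb : 1 ≤ b)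
    (x : EuclideanSpace ℝ (Fin b)) : sigmaMin A * ‖x‖ ≤ ‖toEuclideanLin A x‖ := by
  set T := toEuclideanLin A with hT
  have hfr : Module.finrank ℝ (EuclideanSpace ℝ (Fin b)) = b := by simp
  set S := T.isSymmetric_adjoint_comp_self
  refine le_of_sq_le_sq ?_ (norm_nonneg _)
  have h1 : ‖T x‖ ^ 2 = inner ℝ x ((T.adjoint ∘ₗ T) x) := by
    rw [← real_inner_self_eq_norm_sq, LinearMap.comp_apply, LinearMap.adjoint_inner_right]
  rw [h1, ← (S.eigenvectorBasis hfr).sum_inner_mul_inner, mul_pow,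
    ← (S.eigenvectorBasis hfr).sum_sq_norm_inner_right x, Finset.mul_sum]
  refine Finset.sum_le_sum fun i _ => ?_
  have h2 : inner ℝ (S.eigenvectorBasis hfr i) ((T.adjoint ∘ₗ T) x) =
      S.eigenvalues hfr i * inner ℝ (S.eigenvectorBasis hfr i) x := by
    rw [← S, S.apply_eigenvectorBasis, real_inner_smul_left]
    simp
  rw [h2, ← T.sq_singularValues_fin hfr, real_inner_comm x]
  have h3 : sigmaMin A ≤ T.singularValues i := T.singularValues_antitone (by omega)
  have h4 : 0 ≤ sigmaMin A := T.singularValues_nonneg _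
  have h5 := pow_le_pow_left₀ h4 h3 2
  rw [Real.norm_eq_abs, sq_abs]
  nlinarith [sq_nonneg (inner ℝ (S.eigenvectorBasis hfr i) x : ℝ)]

lemma normF_le_normG (A : Matrix (Fin a) (Fin b) ℝ) : normF A ≤ normG A := by
  have h0 : ∀ j, colNorm A j ≤ maxColNorm A := fun j =>
    le_ciSup (f := fun j : Fin b => √(∑ i, A i j ^ 2)) (Set.finite_range _).bddAbove j
  refine le_of_sq_le_sq ?_ (mul_nonneg (Real.sqrt_nonneg _)
    (Real.iSup_nonneg fun j => Real.sqrt_nonneg _))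
  rw [normG, mul_pow, Real.sq_sqrt (Nat.cast_nonneg _), ← sum_colNorm_sq]
  calc ∑ j, colNorm A j ^ 2 ≤ ∑ j : Fin b, maxColNorm A ^ 2 :=
        Finset.sum_le_sum fun j _ => pow_le_pow_left₀ (colNorm_nonneg _ _) (h0 j) 2
    _ = _ := by simp

end Norms

/-! ### Rounding errors of sums, inner products and substitution steps. -/

section FloatingPoint

lemma u_pos : 0 < u := by unfold u; positivity

lemma u_le : u ≤ 1 / 1000000 := by unfold u; norm_num

/-- The factor `1 / (1 - u)`, which dominates `1 + δ` and `1 / (1 + δ)` for `|δ| ≤ u`. -/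
noncomputable def flGrowth : ℝ := (1 - u)⁻¹

lemma one_le_flGrowth : 1 ≤ flGrowth :=
  (one_le_inv₀ (by linarith [u_le])).2 (by linarith [u_pos])

lemma flGrowth_mul : flGrowth * (1 - u) = 1 :=
  inv_mul_cancel₀ (by linarith [u_le])

lemma one_le_flGrowth_pow (k : ℕ) : 1 ≤ flGrowth ^ k := one_le_pow₀ one_le_flGrowth

lemma flGrowth_pow_mono {k l : ℕ} (h : k ≤ l) : flGrowth ^ k ≤ flGrowth ^ l :=
  pow_le_pow_right₀ one_le_flGrowth h

/-- Bernoulli gives (1-u)^k ≥ 1 - ku, and ku/(1-ku) ≤ (64/63) ku when ku ≤ 1/64. -/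
lemma flGrowth_pow_sub_one_le {k : ℕ} (hk : (k : ℝ) * u ≤ 1 / 64) :
    flGrowth ^ k - 1 ≤ 64 / 63 * (k * u) := by
  have h1 : 1 - (k : ℝ) * u ≤ (1 - u) ^ k := by
    have := one_add_mul_le_pow (a := -u) (by linarith [u_le]) k
    rw [← sub_eq_add_neg] at this
    linarith
  have h2 : flGrowth ^ k * (1 - u) ^ k = 1 := by rw [← mul_pow, flGrowth_mul, one_pow]
  have h3 := one_le_flGrowth_pow k
  have h4 : 0 ≤ (k : ℝ) * u := mul_nonneg (Nat.cast_nonneg _) u_pos.le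
  nlinarith [mul_le_mul_of_nonneg_left h1 (zero_le_one.trans h3)]

lemma abs_one_add_sub_one_le {δ : ℝ} (h : |δ| ≤ u) : |(1 + δ) - 1| ≤ flGrowth - 1 := by
  have h1 := flGrowth_mul
  have h2 := one_le_flGrowth
  rw [add_sub_cancel_left]
  nlinarith [u_pos]

lemma one_add_pos {δ : ℝ} (h : |δ| ≤ u) : 0 < 1 + δ := by
  linarith [u_le, neg_abs_le δ]

lemma abs_one_add_inv_sub_one_le {δ : ℝ} (h : |δ| ≤ u) : |(1 + δ)⁻¹ - 1| ≤ flGrowth - 1 := by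
  have h0 := one_add_pos h
  have h1 := neg_abs_le δ
  have h2 : (1 + δ)⁻¹ ≤ flGrowth := inv_anti₀ (by linarith [u_le]) (by linarith)
  have h3 : 1 - δ ≤ (1 + δ)⁻¹ := by
    rw [le_inv_comm₀ (by linarith [le_abs_self δ, u_le]) h0, inv_eq_one_div,
      le_div_iff₀ (by linarith [le_abs_self δ, u_le])]
    nlinarith [sq_nonneg δ]
  have h4 := abs_one_add_sub_one_le h
  rw [abs_le] at h4 ⊢
  constructor <;> linarith

/-- Composition of relative errors. -/
lemma abs_mul_sub_le {a x X p α β : ℝ} (hx : |x| ≤ X)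
    (ha : |a - x| ≤ (α - 1) * X) (hp : |p - 1| ≤ β - 1) : |a * p - x| ≤ (α * β - 1) * X := by
  have h1 : |p| ≤ β := by
    have := abs_add_le (p - 1) 1
    rw [sub_add_cancel, abs_one] at this
    linarith
  calc |a * p - x| = |(a - x) * p + x * (p - 1)| := by ring_nf
    _ ≤ |a - x| * |p| + |x| * |p - 1| := by
        rw [← abs_mul, ← abs_mul]
        exact abs_add_le _ _
    _ ≤ ((α - 1) * X) * β + X * (β - 1) := by
        gcongr
        · exact (abs_nonneg _).trans ha
        · exact (abs_nonneg _).trans hx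
    _ = _ := by ring

lemma abs_mul_sub_one_le {x y α β : ℝ} (hx : |x - 1| ≤ α - 1)
    (hy : |y - 1| ≤ β - 1) : |x * y - 1| ≤ α * β - 1 := by
  simpa using abs_mul_sub_le (X := 1) (by simp) (by simpa using hx) hy

lemma Multiset.sum_map_abs_nonneg (s : Multiset ℝ) : 0 ≤ (s.map abs).sum :=
  Multiset.sum_nonneg fun x hx => by
    obtain ⟨y, _, rfl⟩ := Multiset.mem_map.1 hx
    exact abs_nonneg y

/-- A sum of k + 1 terms takes k additions under every bracketing, and no term passes through more
than k of them; so the order plays no role. -/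
lemma FlSum.exists_card {s : Multiset ℝ} {r : ℝ} (h : FlSum s r) :
    ∃ k, s.card = k + 1 ∧ |r - s.sum| ≤ (flGrowth ^ k - 1) * (s.map abs).sum := by
  induction h with
  | single x => exact ⟨0, by simp⟩
  | @add s t a b c _ _ hc iha ihb =>
    obtain ⟨k, hk, ha⟩ := iha
    obtain ⟨l, hl, hb⟩ := ihb
    obtain ⟨δ, hδ, rfl⟩ := hc
    refine ⟨k + l + 1, by rw [Multiset.card_add]; omega, ?_⟩
    have hd := abs_one_add_sub_one_le hδ
    have h1 := abs_mul_sub_le s.abs_sum_le_sum_abs ha hd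
    have h2 := abs_mul_sub_le t.abs_sum_le_sum_abs hb hd
    rw [← pow_succ] at h1 h2
    have h3 := mul_le_mul_of_nonneg_right
      (sub_le_sub_right (flGrowth_pow_mono (show k + 1 ≤ k + l + 1 by omega)) 1)
      (Multiset.sum_map_abs_nonneg s)
    have h4 := mul_le_mul_of_nonneg_right
      (sub_le_sub_right (flGrowth_pow_mono (show l + 1 ≤ k + l + 1 by omega)) 1)
      (Multiset.sum_map_abs_nonneg t)
    rw [Multiset.sum_add, Multiset.map_add, Multiset.sum_add]
    calc |(a + b) * (1 + δ) - (s.sum + t.sum)|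
        = |(a * (1 + δ) - s.sum) + (b * (1 + δ) - t.sum)| := by ring_nf
      _ ≤ _ := abs_add_le _ _
      _ ≤ _ := by linarith

/-- Backward error of a sum in which all rounding errors are moved away from one designated
term `x` and onto the result. -/
lemma FlSum.exists_backward {s : Multiset ℝ} {r : ℝ} (h : FlSum s r) :
    ∀ x ∈ s, ∃ k P, s.card = k + 1 ∧ 0 < P ∧ |P - 1| ≤ flGrowth ^ k - 1 ∧
      |s.sum - r * P| ≤ (flGrowth ^ k - 1) * ((s.map abs).sum - |x|) := by
  -- The summand s contains x. The last rounding is undone by the factor (1+δ)⁻¹ in the multiplier,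
  -- while the other summand t pays for its own forward error and for P; the exponents add up to at
  -- most the number of additions.
  have key : ∀ {s t : Multiset ℝ} {a b δ x : ℝ}, |δ| ≤ u → x ∈ s → FlSum t b →
      (∃ k P, s.card = k + 1 ∧ 0 < P ∧ |P - 1| ≤ flGrowth ^ k - 1 ∧
        |s.sum - a * P| ≤ (flGrowth ^ k - 1) * ((s.map abs).sum - |x|)) →
      ∃ k P, (s + t).card = k + 1 ∧ 0 < P ∧ |P - 1| ≤ flGrowth ^ k - 1 ∧
        |(s + t).sum - (a + b) * (1 + δ) * P| ≤
          (flGrowth ^ k - 1) * (((s + t).map abs).sum - |x|) := by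
    rintro s t a b δ x hδ hx hb ⟨k, P, hk, hP, hP1, ha⟩
    obtain ⟨l, hl, hb⟩ := hb.exists_card
    have h0 := one_add_pos hδ
    refine ⟨k + l + 1, P * (1 + δ)⁻¹, by rw [Multiset.card_add]; omega, by positivity, ?_, ?_⟩
    · have := abs_mul_sub_one_le hP1 (abs_one_add_inv_sub_one_le hδ)
      rw [← pow_succ] at this
      exact this.trans (sub_le_sub_right (flGrowth_pow_mono (by omega)) 1)
    · have h1 := abs_mul_sub_le t.abs_sum_le_sum_abs hb hP1
      rw [← pow_add] at h1
      obtain ⟨s', rfl⟩ := Multiset.exists_cons_of_mem hx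
      have hs : ((x ::ₘ s').map abs).sum - |x| = (s'.map abs).sum := by simp
      have h3 := mul_le_mul_of_nonneg_right
        (sub_le_sub_right (flGrowth_pow_mono (show k ≤ k + l + 1 by omega)) 1)
        (Multiset.sum_map_abs_nonneg s')
      have h4 := mul_le_mul_of_nonneg_right
        (sub_le_sub_right (flGrowth_pow_mono (show l + k ≤ k + l + 1 by omega)) 1)
        (Multiset.sum_map_abs_nonneg t)
      rw [hs] at ha
      have hst : ((x ::ₘ s' + t).map abs).sum - |x| = (s'.map abs).sum + (t.map abs).sum := by
        rw [Multiset.map_add, Multiset.sum_add, ← hs]; ring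
      rw [hst, Multiset.sum_add]
      have h5 : (a + b) * (1 + δ) * (P * (1 + δ)⁻¹) = a * P + b * P := by
        field_simp
      rw [h5]
      calc |(x ::ₘ s').sum + t.sum - (a * P + b * P)|
          = |((x ::ₘ s').sum - a * P) - (b * P - t.sum)| := by ring_nf
        _ ≤ _ := abs_sub _ _
        _ ≤ _ := by linarith
  induction h with
  | single x =>
    intro y hy
    obtain rfl := Multiset.mem_singleton.1 hy
    exact ⟨0, 1, by simp⟩
  | @add s t a b c hs ht hc iha ihb =>
    obtain ⟨δ, hδ, rfl⟩ := hc
    intro x hx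
    rcases Multiset.mem_add.1 hx with hx | hx
    · exact key hδ hx ht (iha x hx)
    · rw [add_comm s t, add_comm a b]
      exact key hδ hx hs (ihb x hx)

lemma FlRound.abs_sub_le {x y : ℝ} (h : FlRound x y) : |y - x| ≤ (flGrowth - 1) * |x| := by
  obtain ⟨δ, hδ, rfl⟩ := h
  calc |x * (1 + δ) - x| = |(1 + δ) - 1| * |x| := by rw [← abs_mul]; ring_nf
    _ ≤ _ := mul_le_mul_of_nonneg_right (abs_one_add_sub_one_le hδ) (abs_nonneg _)

lemma FlRound.abs_le {x y : ℝ} (h : FlRound x y) : |y| ≤ flGrowth * |x| := by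
  have h1 := h.abs_sub_le
  have h2 := abs_add_le (y - x) x
  rw [sub_add_cancel] at h2
  linarith

/-- Summing rounded terms with a relative error on the sum. -/
lemma abs_sum_round_le {ι : Type*} (S : Finset ι) (p q : ι → ℝ) (k : ℕ)
    (hq : ∀ i ∈ S, FlRound (p i) (q i)) :
    |∑ i ∈ S, q i - ∑ i ∈ S, p i| + (flGrowth ^ k - 1) * ∑ i ∈ S, |q i| ≤
      (flGrowth ^ (k + 1) - 1) * ∑ i ∈ S, |p i| := by
  have h1 : |∑ i ∈ S, q i - ∑ i ∈ S, p i| ≤ (flGrowth - 1) * ∑ i ∈ S, |p i| := by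
    rw [← Finset.sum_sub_distrib, Finset.mul_sum]
    exact (Finset.abs_sum_le_sum_abs _ _).trans
      (Finset.sum_le_sum fun i hi => (hq i hi).abs_sub_le)
  have h2 : ∑ i ∈ S, |q i| ≤ flGrowth * ∑ i ∈ S, |p i| := by
    rw [Finset.mul_sum]
    exact Finset.sum_le_sum fun i hi => (hq i hi).abs_le
  have h3 := mul_le_mul_of_nonneg_left h2 (sub_nonneg.2 (one_le_flGrowth_pow k))
  rw [pow_succ]
  linarith

lemma FlDot.abs_sub_le {l : ℕ} {x y : Fin l → ℝ} {r : ℝ} (h : FlDot x y r) :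
    |r - ∑ k, x k * y k| ≤ (flGrowth ^ l - 1) * ∑ k, |x k * y k| := by
  obtain ⟨q, hq, hr⟩ := h
  obtain ⟨k, hk, h1⟩ := hr.exists_card
  have h2 := abs_sum_round_le Finset.univ (fun i => x i * y i) q k fun i _ => hq i
  have hl : l = k + 1 := by simpa using hk
  subst hl
  rw [Multiset.map_map] at h1
  have h3 := _root_.abs_sub_le r (∑ i, q i) (∑ i, x i * y i)
  simp only [Function.comp_def] at h1
  change |r - ∑ i, q i| ≤ _ * ∑ i, |q i| at h1
  linarith

/-- Here c is the designated term, so |c| is absent from the error. This is what makes the errors of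
the solves and of Cholesky depend on the computed factors alone. -/
lemma FlSubDot.exists_backward {l : ℕ} {c : ℝ} {i : Fin l} {x y : Fin l → ℝ} {r : ℝ}
    (h : FlSubDot c i x y r) :
    ∃ P, 0 < P ∧ |P - 1| ≤ flGrowth ^ (i : ℕ) - 1 ∧
      |c - ∑ k ∈ Finset.Iio i, x k * y k - r * P| ≤
        (flGrowth ^ ((i : ℕ) + 1) - 1) * ∑ k ∈ Finset.Iio i, |x k * y k| := by
  obtain ⟨q, hq, hr⟩ := h
  obtain ⟨k, P, hk, hP, hP1, h1⟩ := hr.exists_backward c (Multiset.mem_cons_self _ _)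
  have hi : k = i := by
    rw [Multiset.card_cons, Multiset.card_map] at hk
    have : (Finset.Iio i).val.card = i := by simp
    omega
  subst hi
  refine ⟨P, hP, hP1, ?_⟩
  have h2 := abs_sum_round_le (Finset.Iio i) (fun i => x i * y i) q i
    fun k hk => hq k (Finset.mem_Iio.1 hk)
  rw [Multiset.sum_cons, Multiset.map_cons, Multiset.sum_cons, add_sub_cancel_left,
    Multiset.map_map] at h1
  simp only [Function.comp_def, abs_neg] at h1
  change |c + ∑ k ∈ Finset.Iio i, -q k - r * P| ≤ _ * ∑ k ∈ Finset.Iio i, |q k| at h1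
  rw [Finset.sum_neg_distrib] at h1
  calc _ = |(c + -∑ k ∈ Finset.Iio i, q k - r * P) +
        (∑ k ∈ Finset.Iio i, q k - ∑ k ∈ Finset.Iio i, x k * y k)| := by ring_nf
    _ ≤ _ := abs_add_le _ _
    _ ≤ _ := by linarith

/-- Substitution step: the computed `z ≈ (c - ∑ x k * y k) / d`. -/
lemma FlSubDot.abs_sub_le_of_div {l : ℕ} {c : ℝ} {i : Fin l} {x y : Fin l → ℝ} {r d z : ℝ}
    (h : FlSubDot c i x y r) (hd : d ≠ 0) (hz : FlRound (r / d) z) :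
    |c - (∑ k ∈ Finset.Iio i, x k * y k + z * d)| ≤
      (flGrowth ^ ((i : ℕ) + 1) - 1) * (∑ k ∈ Finset.Iio i, |x k * y k| + |z * d|) := by
  obtain ⟨P, hP, hP1, h1⟩ := h.exists_backward
  obtain ⟨δ, hδ, rfl⟩ := hz
  have h0 := (one_add_pos hδ).ne'
  have h2 := abs_mul_sub_one_le hP1 (abs_one_add_inv_sub_one_le hδ)
  rw [← pow_succ] at h2
  have h3 := mul_le_mul_of_nonneg_right h2 (abs_nonneg (r / d * (1 + δ) * d))
  rw [← abs_mul] at h3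
  have h4 : (P * (1 + δ)⁻¹ - 1) * (r / d * (1 + δ) * d) = r * P - r / d * (1 + δ) * d := by
    field_simp
  rw [h4] at h3
  calc _ = |(c - ∑ k ∈ Finset.Iio i, x k * y k - r * P) +
        (r * P - r / d * (1 + δ) * d)| := by ring_nf
    _ ≤ _ := abs_add_le _ _
    _ ≤ _ := by linarith

/-- Pivot step: the computed `z ≈ √(c - ∑ x k * y k)`. -/
lemma FlSubDot.abs_sub_le_of_sqrt {l : ℕ} {c : ℝ} {i : Fin l} {x y : Fin l → ℝ} {r z : ℝ}
    (h : FlSubDot c i x y r) (hr : 0 < r) (hz : FlRound (√r) z) :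
    |c - (∑ k ∈ Finset.Iio i, x k * y k + z * z)| ≤
      (flGrowth ^ ((i : ℕ) + 2) - 1) * (∑ k ∈ Finset.Iio i, |x k * y k| + |z * z|) := by
  obtain ⟨P, hP, hP1, h1⟩ := h.exists_backward
  obtain ⟨δ, hδ, rfl⟩ := hz
  have h0 := (one_add_pos hδ).ne'
  have hd := abs_one_add_inv_sub_one_le hδ
  -- The rounding of the root counts twice because z is squared; hence the exponent i + 2.
  have h2 := abs_mul_sub_one_le (abs_mul_sub_one_le hP1 hd) hd
  rw [← pow_succ, ← pow_succ] at h2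
  have h3 := mul_le_mul_of_nonneg_right h2 (abs_nonneg (√r * (1 + δ) * (√r * (1 + δ))))
  rw [← abs_mul] at h3
  have h4 : (P * (1 + δ)⁻¹ * (1 + δ)⁻¹ - 1) * (√r * (1 + δ) * (√r * (1 + δ))) =
      r * P - √r * (1 + δ) * (√r * (1 + δ)) := by
    rw [sub_mul, one_mul]
    congr 1
    field_simp
    rw [Real.sq_sqrt hr.le]
  rw [h4] at h3
  have h5 := mul_le_mul_of_nonneg_right
    (sub_le_sub_right (flGrowth_pow_mono (show (i : ℕ) + 1 ≤ i + 2 by omega)) 1)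
    (Finset.sum_nonneg fun k (_ : k ∈ Finset.Iio i) => abs_nonneg (x k * y k))
  calc _ = |(c - ∑ k ∈ Finset.Iio i, x k * y k - r * P) +
        (r * P - √r * (1 + δ) * (√r * (1 + δ)))| := by ring_nf
    _ ≤ _ := abs_add_le _ _
    _ ≤ _ := by
      rw [mul_add (flGrowth ^ ((i : ℕ) + 2) - 1)]
      linarith

end FloatingPoint

/-! ### Backward errors of matrix products, triangular solves and Cholesky factorizations. -/

section MatrixErrors

lemma FlMul.abs_sub_le {a l b : ℕ} {A : Matrix (Fin a) (Fin l) ℝ} {B : Matrix (Fin l) (Fin b) ℝ}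
    {C : Matrix (Fin a) (Fin b) ℝ} (h : FlMul A B C) (i : Fin a) (j : Fin b) :
    |C i j - (A * B) i j| ≤ (flGrowth ^ l - 1) * ∑ k, |A i k * B k j| := by
  rw [mul_apply]
  exact (h i j).abs_sub_le

lemma FlMul.normF_sub_le {a l b : ℕ} {A : Matrix (Fin a) (Fin l) ℝ}
    {B : Matrix (Fin l) (Fin b) ℝ} {C : Matrix (Fin a) (Fin b) ℝ} (h : FlMul A B C) :
    normF (C - A * B) ≤ (flGrowth ^ l - 1) * (normF A * normF B) :=
  normF_le_of_abs_le_sum (sub_nonneg.2 (one_le_flGrowth_pow l)) h.abs_sub_le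

lemma sum_eq_sum_Iio_add {n : ℕ} (f : Fin n → ℝ) (j : Fin n) (h : ∀ k, j < k → f k = 0) :
    ∑ k, f k = ∑ k ∈ Finset.Iio j, f k + f j := by
  rw [← Finset.sum_subset (Finset.subset_univ (Finset.Iic j)) fun k _ hk =>
    h k (not_le.1 fun hle => hk (Finset.mem_Iic.2 hle)), ← Finset.Iio_insert j,
    Finset.sum_insert (by simp), add_comm]

lemma FlTriSolve.normF_sub_le {m n : ℕ} {X W : Matrix (Fin m) (Fin n) ℝ}
    {Y : Matrix (Fin n) (Fin n) ℝ} (h : FlTriSolve X Y W) (hY : ∀ i j, j < i → Y i j = 0)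
    (hd : ∀ i, Y i i ≠ 0) :
    normF (W * Y - X) ≤ (flGrowth ^ n - 1) * (normF W * normF Y) := by
  rw [normF_sub_comm]
  refine normF_le_of_abs_le_sum (sub_nonneg.2 (one_le_flGrowth_pow n)) fun i j => ?_
  obtain ⟨c, hc, hz⟩ := h i j
  have h1 := hc.abs_sub_le_of_div (hd j) hz
  rw [Matrix.sub_apply, mul_apply, sum_eq_sum_Iio_add _ j fun k hk => by rw [hY k j hk, mul_zero],
    sum_eq_sum_Iio_add (fun k => |W i k * Y k j|) j fun k hk => by
      rw [hY k j hk, mul_zero, abs_zero]]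
  refine h1.trans (mul_le_mul_of_nonneg_right
    (sub_le_sub_right (flGrowth_pow_mono (by omega)) 1) ?_)
  exact add_nonneg (Finset.sum_nonneg fun k _ => abs_nonneg _) (abs_nonneg _)

/-- The matrix of the first `r` rows of `Y`, padded by zeros. -/
def firstRows {n : ℕ} (Y : Matrix (Fin n) (Fin n) ℝ) (r : ℕ) : Matrix (Fin n) (Fin n) ℝ :=
  fun k j => if (k : ℕ) < r then Y k j else 0

lemma firstRows_self {n : ℕ} (Y : Matrix (Fin n) (Fin n) ℝ) : firstRows Y n = Y := by
  ext k j
  simp [firstRows]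

lemma sum_abs_mul_le_colNorm {a b : ℕ} (A : Matrix (Fin a) (Fin b) ℝ) (i j : Fin b) :
    ∑ k, |A k i * A k j| ≤ colNorm A i * colNorm A j := by
  have h := Real.sum_mul_le_sqrt_mul_sqrt Finset.univ (fun k => |A k i|) (fun k => |A k j|)
  simpa only [abs_mul, colNorm, sq_abs] using h

lemma transpose_mul_self_apply_self {a b : ℕ} (A : Matrix (Fin a) (Fin b) ℝ) (i : Fin b) :
    (Aᵀ * A) i i = colNorm A i ^ 2 := by
  rw [colNorm_sq, mul_apply]
  simp [sq]

lemma transpose_mul_self_comm {a b : ℕ} (A : Matrix (Fin a) (Fin b) ℝ) (i j : Fin b) :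
    (Aᵀ * A) i j = (Aᵀ * A) j i := by
  simp [mul_apply, mul_comm]

/-- Stated for a partial factorization so that it also serves when a later pivot fails. The worst
exponent, i + 2 on the diagonal, is at most n + 1 since i ≤ n - 1; Cauchy–Schwarz then turns the sum
of products into column norms. -/
lemma FlCholeskyRows.abs_sub_le {n : ℕ} {G Y : Matrix (Fin n) (Fin n) ℝ} {r : ℕ}
    (h : FlCholeskyRows G Y r) {i j : Fin n} (hi : (i : ℕ) < r) (hij : i ≤ j) :
    |G i j - ((firstRows Y r)ᵀ * firstRows Y r) i j| ≤
      (flGrowth ^ (n + 1) - 1) * (colNorm (firstRows Y r) i * colNorm (firstRows Y r) j) := by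
  set V := firstRows Y r with hV
  have hVY : ∀ k ≤ i, ∀ l, V k l = Y k l := fun k hk l =>
    if_pos (lt_of_le_of_lt (Fin.le_def.1 hk) hi)
  have hV0 : ∀ k, i < k → V k i = 0 := fun k hk => by
    simp only [hV, firstRows]
    split_ifs with hkr
    · exact (h k hkr).2.2 i hk
    · rfl
  have e1 : (Vᵀ * V) i j = ∑ k ∈ Finset.Iio i, Y k i * Y k j + Y i j * Y i i := by
    rw [mul_apply, sum_eq_sum_Iio_add _ i fun k hk => by rw [transpose_apply, hV0 k hk, zero_mul],
      transpose_apply, hVY i le_rfl, hVY i le_rfl, mul_comm (Y i i)]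
    congr 1
    refine Finset.sum_congr rfl fun k hk => ?_
    have hk := (Finset.mem_Iio.1 hk).le
    rw [transpose_apply, hVY k hk, hVY k hk]
  have e2 : ∑ k ∈ Finset.Iio i, |Y k i * Y k j| + |Y i j * Y i i| ≤
      colNorm V i * colNorm V j := by
    refine le_trans (le_of_eq ?_) (sum_abs_mul_le_colNorm V i j)
    rw [sum_eq_sum_Iio_add _ i fun k hk => by rw [hV0 k hk, zero_mul, abs_zero],
      hVY i le_rfl, hVY i le_rfl, mul_comm (Y i i)]
    congr 1
    refine Finset.sum_congr rfl fun k hk => ?_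
    have hk := (Finset.mem_Iio.1 hk).le
    rw [hVY k hk, hVY k hk]
  have e3 : 0 ≤ ∑ k ∈ Finset.Iio i, |Y k i * Y k j| + |Y i j * Y i i| :=
    add_nonneg (Finset.sum_nonneg fun k _ => abs_nonneg _) (abs_nonneg _)
  have main : ∃ k ≤ n + 1,
      |G i j - (∑ k ∈ Finset.Iio i, Y k i * Y k j + Y i j * Y i i)| ≤ (flGrowth ^ k - 1) *
        (∑ k ∈ Finset.Iio i, |Y k i * Y k j| + |Y i j * Y i i|) := by
    obtain ⟨⟨c, hc, hc0, hz⟩, hoff, -⟩ := h i hi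
    rcases hij.eq_or_lt with rfl | hlt
    · exact ⟨i + 2, by omega, hc.abs_sub_le_of_sqrt hc0 hz⟩
    · obtain ⟨c', hc', hz'⟩ := hoff j hlt
      refine ⟨i + 1, by omega, hc'.abs_sub_le_of_div ?_ hz'⟩
      obtain ⟨δ, hδ, hYi⟩ := hz
      rw [hYi]
      exact (mul_pos (Real.sqrt_pos.2 hc0) (one_add_pos hδ)).ne'
  obtain ⟨k, hk, hmain⟩ := main
  rw [e1]
  refine hmain.trans ?_
  have h1 := sub_le_sub_right (flGrowth_pow_mono hk) 1
  have h2 := sub_nonneg.2 (one_le_flGrowth_pow (n + 1))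
  exact (mul_le_mul_of_nonneg_right h1 e3).trans (mul_le_mul_of_nonneg_left e2 h2)

lemma FlCholesky.diag_pos {n : ℕ} {G Y : Matrix (Fin n) (Fin n) ℝ} (h : FlCholesky G Y)
    (i : Fin n) : 0 < Y i i := by
  obtain ⟨⟨c, -, hc0, δ, hδ, hYi⟩, -, -⟩ := h i i.2
  rw [hYi]
  exact mul_pos (Real.sqrt_pos.2 hc0) (one_add_pos hδ)

lemma FlCholesky.upper {n : ℕ} {G Y : Matrix (Fin n) (Fin n) ℝ} (h : FlCholesky G Y)
    (i j : Fin n) (hij : j < i) : Y i j = 0 := (h i i.2).2.2 j hij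

lemma FlCholesky.isUnit_det {n : ℕ} {G Y : Matrix (Fin n) (Fin n) ℝ} (h : FlCholesky G Y) :
    IsUnit Y.det := by
  have hY : Y.BlockTriangular id := fun i j hij => h.upper i j hij
  rw [det_of_isUpperTriangular hY, isUnit_iff_ne_zero]
  exact Finset.prod_ne_zero_iff.2 fun i _ => (h.diag_pos i).ne'

lemma FlMul.abs_gram_sub_le {s n : ℕ} {A : Matrix (Fin s) (Fin n) ℝ}
    {G : Matrix (Fin n) (Fin n) ℝ} (h : FlMul Aᵀ A G) (i j : Fin n) :
    |G i j - (Aᵀ * A) i j| ≤ (flGrowth ^ s - 1) * (colNorm A i * colNorm A j) :=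
  (h.abs_sub_le i j).trans (mul_le_mul_of_nonneg_left (sum_abs_mul_le_colNorm A i j)
    (sub_nonneg.2 (one_le_flGrowth_pow s)))

variable {s n : ℕ} {A : Matrix (Fin s) (Fin n) ℝ} {G Y : Matrix (Fin n) (Fin n) ℝ}

/-- Diagonal entries give (1 - 1/63)‖V_i‖² ≤ (1 + 1/63)‖A_i‖² with V = `firstRows Y r`, and √(64/62)
< 1.017. -/
lemma FlCholeskyRows.colNorm_le (hG : FlMul Aᵀ A G) {r : ℕ} (h : FlCholeskyRows G Y r)
    (hs : flGrowth ^ s - 1 ≤ 1 / 63) (hn : flGrowth ^ (n + 1) - 1 ≤ 1 / 63) {i : Fin n}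
    (hi : (i : ℕ) < r) : colNorm (firstRows Y r) i ≤ 1.017 * colNorm A i := by
  have h1 := h.abs_sub_le hi le_rfl
  have h2 := hG.abs_gram_sub_le i i
  rw [transpose_mul_self_apply_self, ← sq] at h1 h2
  have h3 := mul_le_mul_of_nonneg_right hs (sq_nonneg (colNorm A i))
  have h4 := mul_le_mul_of_nonneg_right hn (sq_nonneg (colNorm (firstRows Y r) i))
  rw [abs_le] at h1 h2
  refine le_of_sq_le_sq ?_ (mul_nonneg (by norm_num) (colNorm_nonneg _ _))
  nlinarith [sq_nonneg (colNorm A i)]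

/-- Error of the computed Cholesky factor of a computed Gram matrix. -/
lemma FlCholesky.normF_gram_sub_le (hG : FlMul Aᵀ A G) (h : FlCholesky G Y)
    (hs : (s : ℝ) * u ≤ 1 / 64) (hn : ((n : ℝ) + 1) * u ≤ 1 / 64) :
    normF (Yᵀ * Y - Aᵀ * A) ≤ 1.06 * ((s + n + 1) * u) * normF A ^ 2 := by
  have hs' := flGrowth_pow_sub_one_le hs
  have hn' := flGrowth_pow_sub_one_le (k := n + 1) (by push_cast; exact hn)
  push_cast at hn'
  have hsu : 0 ≤ (s : ℝ) * u := mul_nonneg (Nat.cast_nonneg _) u_pos.le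
  have hnu : 0 ≤ ((n : ℝ) + 1) * u := mul_nonneg (by positivity) u_pos.le
  have key : ∀ i j, i ≤ j → |(Yᵀ * Y) i j - (Aᵀ * A) i j| ≤
      1.06 * ((s + n + 1) * u) * (colNorm A i * colNorm A j) := by
    intro i j hij
    have h1 := FlCholeskyRows.abs_sub_le h i.2 hij
    have hc := fun i : Fin n => FlCholeskyRows.colNorm_le (i := i) hG h (by linarith)
      (by linarith) i.2
    simp only [firstRows_self] at h1 hc
    have h2 := hG.abs_gram_sub_le i j
    -- The constants: 1.017² ≤ 1.04 and (64/63)·1.04 ≤ 1.06.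
    have h3 : colNorm Y i * colNorm Y j ≤ 1.04 * (colNorm A i * colNorm A j) := by
      have := mul_le_mul (hc i) (hc j) (colNorm_nonneg _ _)
        (mul_nonneg (by norm_num) (colNorm_nonneg _ _))
      nlinarith [mul_nonneg (colNorm_nonneg A i) (colNorm_nonneg A j)]
    have h4 := mul_le_mul hn' h3 (mul_nonneg (colNorm_nonneg _ _) (colNorm_nonneg _ _))
      (by positivity)
    have h5 := mul_le_mul_of_nonneg_right hs'
      (mul_nonneg (colNorm_nonneg A i) (colNorm_nonneg A j))
    have h6 := mul_nonneg hsu (mul_nonneg (colNorm_nonneg A i) (colNorm_nonneg A j))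
    have h7 := mul_nonneg hnu (mul_nonneg (colNorm_nonneg A i) (colNorm_nonneg A j))
    rw [abs_le] at h1 h2 ⊢
    constructor <;> nlinarith
  refine normF_le_of_abs_le_colNorm (by have := u_pos.le; positivity) fun i j => ?_
  rw [Matrix.sub_apply]
  rcases le_total i j with hij | hij
  · exact key i j hij
  · rw [transpose_mul_self_comm Y, transpose_mul_self_comm A, mul_comm (colNorm A i)]
    exact key j i hij

lemma FlCholesky.normF_le (hG : FlMul Aᵀ A G) (h : FlCholesky G Y)
    (hs : (s : ℝ) * u ≤ 1 / 64) (hn : ((n : ℝ) + 1) * u ≤ 1 / 64) :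
    normF Y ≤ 1.02 * normF A := by
  have hs' := flGrowth_pow_sub_one_le hs
  have hn' := flGrowth_pow_sub_one_le (k := n + 1) (by push_cast; exact hn)
  push_cast at hn'
  refine normF_le_of_colNorm_le (by norm_num) fun i => ?_
  have hc := FlCholeskyRows.colNorm_le (i := i) hG h (by linarith) (by linarith) i.2
  rw [firstRows_self] at hc
  linarith [colNorm_nonneg A i]

/-! ### A failing pivot as a witness of near rank deficiency. -/

lemma inner_toEuclideanLin_eq_sum (M : Matrix (Fin n) (Fin n) ℝ) (x : EuclideanSpace ℝ (Fin n)) :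
    inner ℝ x (toEuclideanLin M x) = ∑ j, ∑ k, x j * x k * M j k := by
  rw [PiLp.inner_apply]
  refine Finset.sum_congr rfl fun j _ => ?_
  rw [toLpLin_apply]
  simp only [mulVec, dotProduct, RCLike.inner_apply, conj_trivial, Finset.sum_mul]
  exact Finset.sum_congr rfl fun k _ => by ring

/-- The first `i` rows have a common null vector supported on the first `i + 1` coordinates. -/
lemma exists_firstRows_apply_eq_zero (Y : Matrix (Fin n) (Fin n) ℝ) (i : Fin n) :
    ∃ x : EuclideanSpace ℝ (Fin n), x ≠ 0 ∧ (∀ k, i < k → x k = 0) ∧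
      toEuclideanLin (firstRows Y i) x = 0 := by
  -- The rows of Y above i, a zero row i, identity rows below: the zero row makes B singular, and
  -- the identity rows force a null vector to vanish beyond i.
  let B : Matrix (Fin n) (Fin n) ℝ := fun k j =>
    if k < i then Y k j else if k = i then 0 else (1 : Matrix (Fin n) (Fin n) ℝ) k j
  have hB : B.det = 0 := det_eq_zero_of_row_eq_zero i fun j => by simp [B]
  obtain ⟨v, hv, hBv⟩ := exists_mulVec_eq_zero_iff.2 hB
  refine ⟨WithLp.toLp 2 v, fun h => hv (by simpa using h), fun k hk => ?_, ?_⟩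
  · have h1 := congrFun hBv k
    have h2 : B k = (1 : Matrix (Fin n) (Fin n) ℝ) k := by
      ext j
      simp [B, hk.not_gt, hk.ne']
    have h3 : (B *ᵥ v) k = ((1 : Matrix (Fin n) (Fin n) ℝ) *ᵥ v) k := by
      simp only [mulVec, h2]
    rw [h3, one_mulVec] at h1
    exact h1
  · ext k
    rw [toLpLin_apply]
    by_cases hk : k < i
    · have h1 := congrFun hBv k
      have h2 : B k = firstRows Y i k := by
        ext j
        simp [B, firstRows, hk]
      simp only [mulVec, h2] at h1
      exact h1
    · have h2 : firstRows Y i k = 0 := by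
        ext j
        simp [firstRows, hk]
      simp [mulVec, h2]

/-- Since cP ≤ 0, the backward error identity can only lose by dropping cP, which leaves g - ‖V_i‖²
≤ (`flGrowth ^ (n + 1)` - 1)‖V_i‖² for the column i of V = `firstRows Y i`. -/
lemma FlSubDot.pivot_le {i : Fin n} {g c : ℝ} (hc0 : c ≤ 0)
    (hc : FlSubDot g i (fun k => Y k i) (fun k => Y k i) c) :
    g ≤ flGrowth ^ (n + 1) * colNorm (firstRows Y i) i ^ 2 := by
  obtain ⟨P, hP, -, h1⟩ := hc.exists_backward
  have e1 : ∑ k ∈ Finset.Iio i, Y k i * Y k i = colNorm (firstRows Y i) i ^ 2 := by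
    rw [colNorm_sq, ← Finset.sum_subset (Finset.subset_univ (Finset.Iio i))]
    · refine Finset.sum_congr rfl fun k hk => ?_
      have : k < i := Finset.mem_Iio.1 hk
      simp [firstRows, this, sq]
    · intro k _ hk
      have : ¬ k < i := by simpa using hk
      simp [firstRows, this]
  have e2 : ∑ k ∈ Finset.Iio i, |Y k i * Y k i| = colNorm (firstRows Y i) i ^ 2 := by
    rw [← e1]
    exact Finset.sum_congr rfl fun k _ => abs_mul_self _
  rw [e1, e2] at h1
  have h2 := mul_le_mul_of_nonneg_right (flGrowth_pow_mono (show (i : ℕ) + 1 ≤ n + 1 by omega))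
    (sq_nonneg (colNorm (firstRows Y i) i))
  have h3 := mul_nonneg (neg_nonneg.2 hc0) hP.le
  have h4 := (le_abs_self _).trans h1
  linarith

/-- If the Cholesky factorization of a computed Gram matrix `AᵀA` can break down, then `A` is
close to being rank deficient. -/
lemma CholeskyMayBreakDown.exists_norm_sq_le (hG : FlMul Aᵀ A G) (h : CholeskyMayBreakDown G)
    (hs : (s : ℝ) * u ≤ 1 / 64) (hn : ((n : ℝ) + 1) * u ≤ 1 / 64) :
    ∃ x : EuclideanSpace ℝ (Fin n), x ≠ 0 ∧
      ‖toEuclideanLin A x‖ ^ 2 ≤ 2.4 * ((s + n + 1) * u) * (normF A ^ 2 * ‖x‖ ^ 2) := by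
  obtain ⟨Y, i, c, hrows, hc, hc0⟩ := h
  obtain ⟨x, hx0, hxs, hVx⟩ := exists_firstRows_apply_eq_zero Y i
  refine ⟨x, hx0, ?_⟩
  have hs' := flGrowth_pow_sub_one_le hs
  have hn' := flGrowth_pow_sub_one_le (k := n + 1) (by push_cast; exact hn)
  push_cast at hn'
  have hcol : ∀ j : Fin n, j < i → colNorm (firstRows Y i) j ≤ 1.017 * colNorm A j :=
    fun j hj => hrows.colNorm_le hG (by linarith) (by linarith) hj
  have hpiv := hc.pivot_le hc0
  set V := firstRows Y i with hV
  set γs := flGrowth ^ s - 1 with hγs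
  set γ := flGrowth ^ (n + 1) - 1 with hγ
  have hγs0 : 0 ≤ γs := sub_nonneg.2 (one_le_flGrowth_pow s)
  have hγ0 : 0 ≤ γ := sub_nonneg.2 (one_le_flGrowth_pow _)
  set v := colNorm V i
  have hv0 : 0 ≤ v := colNorm_nonneg _ _
  -- The amount by which the pivot fails. Column i of V is not yet controlled by A, so v may be
  -- large; but then d is large too, and d enters the quadratic form with a favourable sign.
  set d := (1 + γ) * v ^ 2 - G i i with hd
  have hd0 : 0 ≤ d := by
    have : flGrowth ^ (n + 1) = 1 + γ := by rw [hγ]; ring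
    rw [this] at hpiv
    linarith
  set p : Fin n → ℝ := fun j => if j = i then v else 1.017 * colNorm A j with hp
  have hp0 : ∀ j, 0 ≤ p j := fun j => by
    simp only [hp]
    split_ifs
    · exact hv0
    · exact mul_nonneg (by norm_num) (colNorm_nonneg _ _)
  have hcp : ∀ j ≤ i, colNorm V j ≤ p j := fun j hj => by
    rcases hj.eq_or_lt with rfl | hlt
    · simp [hp, v]
    · simp only [hp, if_neg hlt.ne]
      exact hcol j hlt
  have hentry : ∀ j k, j < i → j ≤ k → k ≤ i → |(Aᵀ * A) j k - (Vᵀ * V) j k| ≤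
      γs * (colNorm A j * colNorm A k) + γ * (p j * p k) := by
    intro j k hj hjk hk
    have h1 := hrows.abs_sub_le (i := j) (j := k) hj hjk
    have h2 := hG.abs_gram_sub_le j k
    have h3 := mul_le_mul_of_nonneg_left
      (mul_le_mul (hcp j hj.le) (hcp k hk) (colNorm_nonneg _ _) (hp0 j)) hγ0
    rw [← hV] at h1
    rw [abs_le] at h1 h2 ⊢
    constructor <;> linarith
  -- Pairs with an index beyond i vanish by the support of x. The other pairs are covered by
  -- `hentry` and symmetry, except (i, i), where the failed pivot supplies the gain -d x_i².
  have hterm : ∀ j k, x j * x k * ((Aᵀ * A) j k - (Vᵀ * V) j k) ≤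
      γs * ((|x j| * colNorm A j) * (|x k| * colNorm A k)) + γ * ((|x j| * p j) * (|x k| * p k)) -
        (if j = i then if k = i then d * x i ^ 2 else 0 else 0) := by
    intro j k
    have hoff : |(Aᵀ * A) j k - (Vᵀ * V) j k| ≤
        γs * (colNorm A j * colNorm A k) + γ * (p j * p k) →
        x j * x k * ((Aᵀ * A) j k - (Vᵀ * V) j k) ≤
          γs * ((|x j| * colNorm A j) * (|x k| * colNorm A k)) +
            γ * ((|x j| * p j) * (|x k| * p k)) := by
      intro h1
      refine (le_abs_self _).trans ?_
      rw [abs_mul, abs_mul]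
      have := mul_le_mul_of_nonneg_left h1 (mul_nonneg (abs_nonneg (x j)) (abs_nonneg (x k)))
      linarith
    rcases lt_or_ge i j with hj | hj
    · rw [hxs j hj, if_neg hj.ne']
      simp
    rcases lt_or_ge i k with hk | hk
    · rw [hxs k hk, if_neg hk.ne']
      simp
    by_cases hji : j = i
    · subst hji
      by_cases hki : k = j
      · subst hki
        rw [if_pos rfl, if_pos rfl]
        have h2 := (abs_le.1 (hG.abs_gram_sub_le k k)).1
        have h3 : (Aᵀ * A) k k - (Vᵀ * V) k k ≤
            γs * (colNorm A k * colNorm A k) + γ * (p k * p k) - d := by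
          rw [transpose_mul_self_apply_self V]
          simp only [hp, if_true]
          change _ - v ^ 2 ≤ _
          linarith
        have h4 := mul_le_mul_of_nonneg_left h3 (sq_nonneg (x k))
        have h5 : |x k| * |x k| = x k ^ 2 := by rw [abs_mul_abs_self, sq]
        calc _ = x k ^ 2 * ((Aᵀ * A) k k - (Vᵀ * V) k k) := by ring
          _ ≤ _ := h4
          _ = _ := by rw [← h5]; ring
      · rw [if_neg hki, if_pos rfl, sub_zero]
        refine hoff ?_
        have := hentry k j (lt_of_le_of_ne hk hki) hk le_rfl
        rw [transpose_mul_self_comm A, transpose_mul_self_comm V, mul_comm (colNorm A j),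
          mul_comm (p j)]
        exact this
    · rw [if_neg hji, sub_zero]
      refine hoff ?_
      have hj' := lt_of_le_of_ne hj hji
      rcases le_total j k with hjk | hkj
      · exact hentry j k hj' hjk hk
      · have := hentry k j (lt_of_le_of_lt hkj hj') hkj hj
        rw [transpose_mul_self_comm A, transpose_mul_self_comm V, mul_comm (colNorm A j),
          mul_comm (p j)]
        exact this
  have hsum : ‖toEuclideanLin A x‖ ^ 2 ≤
      γs * (∑ j, |x j| * colNorm A j) ^ 2 + γ * (∑ j, |x j| * p j) ^ 2 - d * x i ^ 2 := by
    have h1 : ‖toEuclideanLin A x‖ ^ 2 =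
        ∑ j, ∑ k, x j * x k * ((Aᵀ * A) j k - (Vᵀ * V) j k) := by
      have h2 : ‖toEuclideanLin A x‖ ^ 2 - ‖toEuclideanLin V x‖ ^ 2 =
          inner ℝ x (toEuclideanLin (Aᵀ * A - Vᵀ * V) x) := by
        rw [norm_toEuclideanLin_sq, norm_toEuclideanLin_sq, map_sub, LinearMap.sub_apply,
          inner_sub_right]
      rw [hVx, norm_zero, inner_toEuclideanLin_eq_sum] at h2
      simpa using h2
    rw [h1]
    refine (Finset.sum_le_sum fun j _ => Finset.sum_le_sum fun k _ => hterm j k).trans_eq ?_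
    simp only [Finset.sum_sub_distrib, Finset.sum_add_distrib, ← Finset.mul_sum]
    rw [sq (∑ j, |x j| * colNorm A j), Finset.sum_mul_sum, sq (∑ j, |x j| * p j),
      Finset.sum_mul_sum]
    simp only [← Finset.mul_sum]
    simp
  set a := ∑ j, |x j| * colNorm A j with ha
  have ha0 : 0 ≤ a := Finset.sum_nonneg fun j _ => mul_nonneg (abs_nonneg _) (colNorm_nonneg _ _)
  -- From v² ≤ (1+γ)v² = G_ii + d ≤ (64/63)‖A_i‖² + d.
  have hvi : v ≤ 1.017 * colNorm A i + √d := by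
    refine le_of_sq_le_sq ?_
      (add_nonneg (mul_nonneg (by norm_num) (colNorm_nonneg _ _)) (Real.sqrt_nonneg _))
    have h2 := (abs_le.1 (hG.abs_gram_sub_le i i)).2
    rw [transpose_mul_self_apply_self, ← sq, ← hγs] at h2
    have h3 := mul_le_mul_of_nonneg_right (show γs ≤ 1 / 63 by linarith)
      (sq_nonneg (colNorm A i))
    nlinarith [Real.sq_sqrt hd0, mul_nonneg (colNorm_nonneg A i) (Real.sqrt_nonneg d),
      mul_nonneg hγ0 (sq_nonneg v), sq_nonneg (colNorm A i)]
  have hpsum : ∑ j, |x j| * p j ≤ 1.017 * a + |x i| * √d := by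
    have h1 : ∀ j, |x j| * p j ≤ 1.017 * (|x j| * colNorm A j) +
        if j = i then |x i| * √d else 0 := by
      intro j
      by_cases hj : j = i
      · subst hj
        simp only [hp, if_true]
        nlinarith [mul_le_mul_of_nonneg_left hvi (abs_nonneg (x j))]
      · simp only [hp, if_neg hj]
        linarith
    refine (Finset.sum_le_sum fun j _ => h1 j).trans_eq ?_
    rw [Finset.sum_add_distrib, ← Finset.mul_sum]
    simp [ha]
  -- (y + z)² ≤ 2y² + 2z², with 2·1.017² ≤ 2.07.
  have hpsq : (∑ j, |x j| * p j) ^ 2 ≤ 2.07 * a ^ 2 + 2 * (d * x i ^ 2) := by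
    have h1 := pow_le_pow_left₀
      (Finset.sum_nonneg fun j _ => mul_nonneg (abs_nonneg (x j)) (hp0 j)) hpsum 2
    have h2 : (|x i| * √d) ^ 2 = d * x i ^ 2 := by
      rw [mul_pow, sq_abs, Real.sq_sqrt hd0, mul_comm]
    nlinarith [sq_nonneg (1.017 * a - |x i| * √d), sq_nonneg a]
  have hγle : γ ≤ 1 / 63 := by linarith
  have hdx : 0 ≤ d * x i ^ 2 := mul_nonneg hd0 (sq_nonneg _)
  -- As 2γ ≤ 2/63 < 1, the gain -d x_i² absorbs the term 2γ d x_i².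
  have h1 : ‖toEuclideanLin A x‖ ^ 2 ≤ (γs + 2.07 * γ) * a ^ 2 := by
    have h2 := mul_le_mul_of_nonneg_left hpsq hγ0
    have h3 := mul_le_mul_of_nonneg_right hγle hdx
    linarith
  have h2 : γs + 2.07 * γ ≤ 2.4 * ((s + n + 1) * u) := by
    have hsu : 0 ≤ (s : ℝ) * u := mul_nonneg (Nat.cast_nonneg _) u_pos.le
    have hnu : 0 ≤ ((n : ℝ) + 1) * u := mul_nonneg (by positivity) u_pos.le
    linarith
  exact h1.trans (mul_le_mul h2 (sum_abs_mul_colNorm_le A x) (sq_nonneg _)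
    (by have := u_pos.le; positivity))

end MatrixErrors

/-! ### CholeskyQR of a well-conditioned matrix. -/

section SecondPass

lemma norm2_mul_inv_le {a n : ℕ} (W : Matrix (Fin a) (Fin n) ℝ) {Z : Matrix (Fin n) (Fin n) ℝ}
    (hZ : IsUnit Z.det) {c : ℝ} (hc : 0 ≤ c)
    (h : ∀ x, ‖toEuclideanLin W x‖ ≤ c * ‖toEuclideanLin Z x‖) : norm2 (W * Z⁻¹) ≤ c := by
  refine norm2_le _ hc fun x => ?_
  have h1 := h (toEuclideanLin Z⁻¹ x)
  rw [← toEuclideanLin_mul, ← toEuclideanLin_mul, mul_nonsing_inv _ hZ] at h1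
  simpa [toLpLin_apply] using h1

lemma norm2_inv_le {n : ℕ} {Z : Matrix (Fin n) (Fin n) ℝ}
    (hZ : IsUnit Z.det) {c : ℝ} (hc : 0 ≤ c)
    (h : ∀ x, ‖x‖ ≤ c * ‖toEuclideanLin Z x‖) : norm2 Z⁻¹ ≤ c := by
  have := norm2_mul_inv_le (1 : Matrix (Fin n) (Fin n) ℝ) hZ hc fun x => by
    simpa [toLpLin_apply] using h x
  rwa [one_mul] at this

/-- Write Q = B + F with B = WZ⁻¹ and F = (QZ - W)Z⁻¹. Since Z⁻ᵀ(ZᵀZ)Z⁻¹ = 1, BᵀB - 1 is minus the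
Gram error of Z conjugated by Z⁻¹; the cross terms and FᵀF account for the rest. -/
lemma normF_gram_sub_one_le {m n : ℕ} {Q W : Matrix (Fin m) (Fin n) ℝ}
    {Z : Matrix (Fin n) (Fin n) ℝ} (hZ : IsUnit Z.det) :
    normF (Qᵀ * Q - 1) ≤ norm2 Z⁻¹ ^ 2 * normF (Zᵀ * Z - Wᵀ * W) +
      2 * norm2 (W * Z⁻¹) * normF ((Q * Z - W) * Z⁻¹) + normF ((Q * Z - W) * Z⁻¹) ^ 2 := by
  set T := Z⁻¹ with hT
  set F := (Q * Z - W) * T with hF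
  set B := W * T with hB
  have hZT : Z * T = 1 := mul_nonsing_inv _ hZ
  have hQ : Q = B + F := by
    rw [hB, hF, Matrix.sub_mul, Matrix.mul_assoc, hZT, Matrix.mul_one, add_sub_cancel]
  have h1 : Tᵀ * (Zᵀ * Z) * T = 1 := by
    rw [← Matrix.mul_assoc, ← transpose_mul, hZT, Matrix.mul_assoc, hZT]
    simp
  have h2 : Qᵀ * Q - 1 = (-(Tᵀ * (Zᵀ * Z - Wᵀ * W) * T) + (Bᵀ * F + Fᵀ * B)) + Fᵀ * F := by
    rw [Matrix.mul_sub, Matrix.sub_mul, h1, hQ, transpose_add, Matrix.add_mul, Matrix.mul_add,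
      Matrix.mul_add]
    have h3 : Tᵀ * (Wᵀ * W) * T = Bᵀ * B := by
      rw [hB, transpose_mul]
      simp only [Matrix.mul_assoc]
    rw [h3]
    abel
  have n1 : normF (Tᵀ * (Zᵀ * Z - Wᵀ * W) * T) ≤ norm2 T ^ 2 * normF (Zᵀ * Z - Wᵀ * W) := by
    refine (normF_mul_le_mul_norm2 _ _).trans ?_
    have := mul_le_mul_of_nonneg_right (normF_mul_le_norm2_mul Tᵀ (Zᵀ * Z - Wᵀ * W))
      (norm2_nonneg T)
    rw [norm2_transpose] at this
    linarith
  have n2 : normF (Bᵀ * F) ≤ norm2 B * normF F := by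
    rw [← norm2_transpose B]
    exact normF_mul_le_norm2_mul _ _
  have n3 : normF (Fᵀ * B) ≤ norm2 B * normF F := by
    rw [← normF_transpose F, mul_comm]
    exact normF_mul_le_mul_norm2 _ _
  have n4 : normF (Fᵀ * F) ≤ normF F ^ 2 := by
    rw [sq]
    exact (normF_mul_le Fᵀ F).trans_eq (by rw [normF_transpose])
  rw [h2]
  have t1 := normF_add_le (-(Tᵀ * (Zᵀ * Z - Wᵀ * W) * T) + (Bᵀ * F + Fᵀ * B)) (Fᵀ * F)
  have t2 := normF_add_le (-(Tᵀ * (Zᵀ * Z - Wᵀ * W) * T)) (Bᵀ * F + Fᵀ * B)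
  have t3 := normF_add_le (Bᵀ * F) (Fᵀ * B)
  rw [normF_neg] at t2
  linarith

lemma norm2_le_of_gram {m n : ℕ} {Q : Matrix (Fin m) (Fin n) ℝ} {h : ℝ}
    (hQ : normF (Qᵀ * Q - 1) ≤ h) : norm2 Q ≤ √(1 + h) := by
  refine norm2_le _ (Real.sqrt_nonneg _) fun x => ?_
  have h0 := (normF_nonneg _).trans hQ
  refine le_of_sq_le_sq ?_ (mul_nonneg (Real.sqrt_nonneg _) (norm_nonneg _))
  rw [mul_pow, Real.sq_sqrt (by linarith)]
  have h1 := abs_norm_sq_sub_le (1 : Matrix (Fin n) (Fin n) ℝ) Q x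
  rw [transpose_one, one_mul] at h1
  have h2 : toEuclideanLin (1 : Matrix (Fin n) (Fin n) ℝ) x = x := by simp
  rw [h2] at h1
  have h3 := mul_le_mul_of_nonneg_right hQ (sq_nonneg ‖x‖)
  linarith [(abs_le.1 h1).2]

lemma FlTriSolve.normF_sub_le_of_cholesky {m n : ℕ} {X W : Matrix (Fin m) (Fin n) ℝ}
    {G Y : Matrix (Fin n) (Fin n) ℝ} (hY : FlCholesky G Y) (h : FlTriSolve X Y W)
    (hn : (n : ℝ) * u ≤ 1 / 64) :
    normF (W * Y - X) ≤ 64 / 63 * (n * u) * (normF W * normF Y) :=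
  (h.normF_sub_le hY.upper fun i => (hY.diag_pos i).ne').trans
    (mul_le_mul_of_nonneg_right (flGrowth_pow_sub_one_le hn)
      (mul_nonneg (normF_nonneg _) (normF_nonneg _)))

variable {m n : ℕ} {W : Matrix (Fin m) (Fin n) ℝ} {b ω : ℝ}

/-- The origin of mnu + n(n+1)u: the factor n in ‖W‖_F² ≤ n‖W‖₂² multiplies the Gram and Cholesky
error (m+n+1)u. -/
lemma normF_sq_mul_le (hW : norm2 W ≤ b * ω) :
    (m + n + 1) * u * normF W ^ 2 ≤ b ^ 2 * (m * n * u + n * (n + 1) * u) * ω ^ 2 := by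
  have h1 := pow_le_pow_left₀ (normF_nonneg W) (normF_le_sqrt_mul_norm2 W) 2
  rw [mul_pow, Real.sq_sqrt (Nat.cast_nonneg _)] at h1
  have h2 := pow_le_pow_left₀ (norm2_nonneg W) hW 2
  have h3 : normF W ^ 2 ≤ n * (b * ω) ^ 2 :=
    h1.trans (mul_le_mul_of_nonneg_left h2 (Nat.cast_nonneg _))
  refine (mul_le_mul_of_nonneg_left h3 (by have := u_pos.le; positivity)).trans_eq ?_
  ring

/-- The second pass cannot break down. -/
lemma not_choleskyMayBreakDown_of_wellConditioned (hω : 0 < ω)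
    (hW : norm2 W ≤ b * ω) (hWω : ∀ x, ω * ‖x‖ ≤ ‖toEuclideanLin W x‖)
    (hb : b ^ 2 * (m * n * u + n * (n + 1) * u) ≤ 1 / 64)
    (hm : (m : ℝ) * u ≤ 1 / 64) (hn : ((n : ℝ) + 1) * u ≤ 1 / 64)
    {C : Matrix (Fin n) (Fin n) ℝ} (hC : FlMul Wᵀ W C) : ¬ CholeskyMayBreakDown C := by
  intro hbr
  obtain ⟨x, hx0, hx⟩ := hbr.exists_norm_sq_le hC hm hn
  have h1 := normF_sq_mul_le hW
  have hxp : 0 < ‖x‖ ^ 2 := pow_pos (norm_pos_iff.2 hx0) 2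
  have h2 := pow_le_pow_left₀ (mul_nonneg hω.le (norm_nonneg x)) (hWω x) 2
  rw [mul_pow] at h2
  have h3 : (m + n + 1) * u * normF W ^ 2 ≤ 1 / 64 * ω ^ 2 :=
    h1.trans (mul_le_mul_of_nonneg_right hb (sq_nonneg _))
  have h4 := mul_le_mul_of_nonneg_right h3 hxp.le
  have h5 : 0 < ω ^ 2 * ‖x‖ ^ 2 := by positivity
  -- Breakdown would give ω²‖x‖² ≤ (2.4/64) ω²‖x‖².
  nlinarith

/-- Loss of orthogonality in the second pass. -/
lemma FlCholesky.normF_gram_sub_one_le {C Z : Matrix (Fin n) (Fin n) ℝ}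
    {Q : Matrix (Fin m) (Fin n) ℝ} (hω : 0 < ω) (hb1 : 1 ≤ b)
    (hW : norm2 W ≤ b * ω) (hWω : ∀ x, ω * ‖x‖ ≤ ‖toEuclideanLin W x‖)
    (hb : b ^ 2 * (m * n * u + n * (n + 1) * u) ≤ 1 / 64)
    (hm : (m : ℝ) * u ≤ 1 / 64) (hn : ((n : ℝ) + 1) * u ≤ 1 / 64)
    (hC : FlMul Wᵀ W C) (hZ : FlCholesky C Z) (hQ : FlTriSolve W Z Q) :
    normF (Qᵀ * Q - 1) ≤ 5 * b ^ 2 * (m * n * u + n * (n + 1) * u) := by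
  set η := (m : ℝ) * n * u + n * (n + 1) * u with hη
  have hu := u_pos
  have hn' : (n : ℝ) * u ≤ 1 / 64 := by linarith
  have hnu : 0 ≤ (n : ℝ) * u := by positivity
  have hE := hZ.normF_gram_sub_le hC hm hn
  have hWF := normF_sq_mul_le hW
  rw [← hη] at hWF
  have hE1 : normF (Zᵀ * Z - Wᵀ * W) ≤ 1.06 * (b ^ 2 * η) * ω ^ 2 := by linarith
  have hZx : ∀ x, ‖toEuclideanLin W x‖ ≤ 1.0102 * ‖toEuclideanLin Z x‖ := by
    intro x
    refine le_of_sq_le_sq ?_ (by positivity)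
    have h1 := (abs_le.1 (abs_norm_sq_sub_le W Z x)).1
    have h2 := pow_le_pow_left₀ (mul_nonneg hω.le (norm_nonneg x)) (hWω x) 2
    rw [mul_pow] at h2
    have h3 : normF (Zᵀ * Z - Wᵀ * W) * ‖x‖ ^ 2 ≤ 1.06 * (1 / 64) * (ω ^ 2 * ‖x‖ ^ 2) := by
      have h4 : normF (Zᵀ * Z - Wᵀ * W) ≤ 1.06 * (1 / 64) * ω ^ 2 :=
        hE1.trans (mul_le_mul_of_nonneg_right
          (mul_le_mul_of_nonneg_left hb (by norm_num)) (sq_nonneg _))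
      linarith [mul_le_mul_of_nonneg_right h4 (sq_nonneg ‖x‖)]
    nlinarith
  have hdet := hZ.isUnit_det
  have hT : norm2 Z⁻¹ ≤ 1.0102 / ω := by
    refine norm2_inv_le hdet (by positivity) fun x => ?_
    rw [div_mul_eq_mul_div, le_div_iff₀ hω, mul_comm]
    exact (hWω x).trans (hZx x)
  have hB := norm2_mul_inv_le W hdet (by norm_num) hZx
  have hmain := RandCholQR.normF_gram_sub_one_le (Q := Q) (W := W) hdet
  set f := normF ((Q * Z - W) * Z⁻¹) with hf
  have hf0 : 0 ≤ f := normF_nonneg _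
  have hsn := Real.sq_sqrt (Nat.cast_nonneg (α := ℝ) n)
  have hZF : normF Z ≤ 1.02 * (√n * (b * ω)) :=
    (hZ.normF_le hC hm hn).trans (mul_le_mul_of_nonneg_left
      ((normF_le_sqrt_mul_norm2 W).trans
        (mul_le_mul_of_nonneg_left hW (Real.sqrt_nonneg _))) (by norm_num))
  have hν0 : 0 ≤ n * √n * u * b := by positivity
  -- The solve error is relative to the computed Q, whose size is still unknown; in `hQF` below it
  -- is absorbed, because n√n u b ≤ 1/64.
  have hfQ : f ≤ 1.05 * (n * √n * u * b) * normF Q := by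
    have h1 := (normF_mul_le_mul_norm2 (Q * Z - W) Z⁻¹).trans
      (mul_le_mul (hQ.normF_sub_le_of_cholesky hZ hn') hT (norm2_nonneg _)
        (by have := normF_nonneg Q; have := normF_nonneg Z; positivity))
    have h2 : 64 / 63 * (n * u) * (normF Q * normF Z) * (1.0102 / ω) ≤
        64 / 63 * (n * u) * (normF Q * (1.02 * (√n * (b * ω)))) * (1.0102 / ω) := by
      have := normF_nonneg Q
      gcongr
    have h3 : 64 / 63 * (n * u) * (normF Q * (1.02 * (√n * (b * ω)))) * (1.0102 / ω) =
        (64 / 63 * 1.02 * 1.0102) * ((n * √n * u * b) * normF Q) := by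
      field_simp
    have h4 := mul_nonneg hν0 (normF_nonneg Q)
    rw [h3] at h2
    linarith
  have hηn : n ^ 2 * u ≤ η := by
    have : 0 ≤ (m : ℝ) * n * u := by positivity
    rw [hη]
    linarith
  -- Its square is (b² n²u)(nu), and both factors are at most 1/64.
  have hν : n * √n * u * b ≤ 1 / 64 := by
    refine le_of_sq_le_sq ?_ (by norm_num)
    have h1 : (n * √n * u * b) ^ 2 = (b ^ 2 * (n ^ 2 * u)) * (n * u) := by
      rw [mul_pow, mul_pow, mul_pow, hsn]
      ring
    rw [h1, sq (1 / 64 : ℝ)]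
    exact mul_le_mul ((mul_le_mul_of_nonneg_left hηn (sq_nonneg b)).trans hb) hn' hnu
      (by norm_num)
  have hQF : normF Q ≤ 1.03 * √n := by
    have h1 : Q = W * Z⁻¹ + (Q * Z - W) * Z⁻¹ := by
      rw [← Matrix.add_mul, add_sub_cancel, Matrix.mul_assoc, mul_nonsing_inv _ hdet,
        Matrix.mul_one]
    have h2 : normF Q ≤ normF (W * Z⁻¹) + f := by
      conv_lhs => rw [h1]
      exact normF_add_le _ _
    have h3 := (normF_le_sqrt_mul_norm2 (W * Z⁻¹)).trans
      (mul_le_mul_of_nonneg_left hB (Real.sqrt_nonneg _))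
    have h4 := mul_le_mul_of_nonneg_right hν (normF_nonneg Q)
    linarith [Real.sqrt_nonneg (n : ℝ)]
  have hq0 : 0 ≤ b ^ 2 * η := by positivity
  have hfq : f ≤ 1.082 * (b ^ 2 * η) := by
    have h1 := mul_le_mul_of_nonneg_left hQF hν0
    have h2 : n * √n * u * b * (1.03 * √n) = 1.03 * (b * (n ^ 2 * u)) := by
      linear_combination (1.03 * n * u * b) * hsn
    have h3 : b * (n ^ 2 * u) ≤ b ^ 2 * η :=
      mul_le_mul (by nlinarith) hηn (by positivity) (by positivity)
    linarith
  have a1 : norm2 Z⁻¹ ^ 2 * normF (Zᵀ * Z - Wᵀ * W) ≤ 1.09 * (b ^ 2 * η) := by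
    calc _ ≤ (1.0102 / ω) ^ 2 * (1.06 * (b ^ 2 * η) * ω ^ 2) :=
          mul_le_mul (pow_le_pow_left₀ (norm2_nonneg _) hT 2) hE1 (normF_nonneg _) (by positivity)
      _ = (1.0102 ^ 2 * 1.06) * (b ^ 2 * η) := by field_simp
      _ ≤ _ := mul_le_mul_of_nonneg_right (by norm_num) hq0
  have a2 : norm2 (W * Z⁻¹) * f ≤ 1.0102 * (1.082 * (b ^ 2 * η)) :=
    mul_le_mul hB hfq hf0 (by norm_num)
  have a3 : f ^ 2 ≤ 0.1 * (b ^ 2 * η) := by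
    have h1 := pow_le_pow_left₀ hf0 hfq 2
    have h2 := mul_le_mul_of_nonneg_left hb hq0
    linarith
  -- 1.09 + 2·1.0102·1.082 + 0.1 < 5.
  linarith

end SecondPass

/-! ### The sketched Cholesky factor as a preconditioner. -/

section FirstPass

variable {s m n : ℕ} {Ω : Matrix (Fin s) (Fin m) ℝ} {X : Matrix (Fin m) (Fin n) ℝ}
  {A : Matrix (Fin s) (Fin n) ℝ} {α β σ F : ℝ}

lemma t1_nonneg (Ω : Matrix (Fin s) (Fin m) ℝ) : 0 ≤ t1 Ω := by
  have := u_pos.le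
  have := norm2_nonneg Ω
  unfold t1
  positivity

/-- `t1` is the product error constant times √s‖Ω‖₂ ≥ ‖Ω‖_F; the root is of s, not m, because the
bound is applied to Ωᵀ. -/
lemma FlMul.normF_sketch_sub_le (hA : FlMul Ω X A) (hF : normF X ≤ F)
    (hm : (m : ℝ) * u ≤ 1 / 64) : normF (A - Ω * X) ≤ t1 Ω * F := by
  have hu := u_pos.le
  have hΩ : normF Ω ≤ √s * norm2 Ω := by
    rw [← normF_transpose, ← norm2_transpose]
    exact normF_le_sqrt_mul_norm2 _
  have h1 : flGrowth ^ m - 1 ≤ 1.1 * m * u := by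
    have h2 := flGrowth_pow_sub_one_le hm
    have h3 : 0 ≤ (m : ℝ) * u := by positivity
    linarith
  have h0 := norm2_nonneg Ω
  refine hA.normF_sub_le.trans ?_
  rw [t1, mul_assoc (1.1 * (m : ℝ) * u)]
  exact mul_le_mul h1 (mul_le_mul hΩ hF (normF_nonneg _) (by positivity))
    (mul_nonneg (normF_nonneg _) (normF_nonneg _)) (by positivity)

lemma FlMul.normF_sketch_le (hA : FlMul Ω X A) (hF : normF X ≤ F) (hm : (m : ℝ) * u ≤ 1 / 64)
    (hβ : 0 ≤ β) (hup : ∀ x, ‖toEuclideanLin (Ω * X) x‖ ≤ β * ‖toEuclideanLin X x‖) :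
    normF A ≤ (β + t1 Ω) * F := by
  have h1 : normF (Ω * X) ≤ β * normF X := normF_le_of_colNorm_le hβ fun j => by
    rw [colNorm_eq, colNorm_eq]
    exact hup _
  have h2 := normF_add_le (Ω * X) (A - Ω * X)
  rw [add_sub_cancel] at h2
  have h3 := hA.normF_sketch_sub_le hF hm
  have h4 := mul_le_mul_of_nonneg_left hF hβ
  linarith

lemma FlMul.norm_sketch_sub_le (hA : FlMul Ω X A) (hF : normF X ≤ F)
    (hm : (m : ℝ) * u ≤ 1 / 64) (x : EuclideanSpace ℝ (Fin n)) :
    ‖toEuclideanLin A x - toEuclideanLin (Ω * X) x‖ ≤ t1 Ω * F * ‖x‖ := by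
  rw [← LinearMap.sub_apply, ← map_sub]
  exact (norm_toEuclideanLin_le _ x).trans (mul_le_mul_of_nonneg_right
    ((norm2_le_normF _).trans (hA.normF_sketch_sub_le hF hm)) (norm_nonneg x))

lemma FlCholesky.eq_add_solve_error {G Y : Matrix (Fin n) (Fin n) ℝ} (hY : FlCholesky G Y)
    (X W : Matrix (Fin m) (Fin n) ℝ) : W = X * Y⁻¹ + (W * Y - X) * Y⁻¹ := by
  rw [← Matrix.add_mul, add_sub_cancel, Matrix.mul_assoc, mul_nonsing_inv _ hY.isUnit_det,
    Matrix.mul_one]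

/-- The hypotheses on the sketch: `α`, `β` are the embedding constants, `σ` a lower bound for the
singular values of `X`, `F` an upper bound for its Frobenius norm. -/
structure SketchBounds (Ω : Matrix (Fin s) (Fin m) ℝ) (X : Matrix (Fin m) (Fin n) ℝ)
    (α β σ F : ℝ) : Prop where
  α_pos : 0 < α
  α_le_β : α ≤ β
  σ_pos : 0 < σ
  low : ∀ x, α * ‖toEuclideanLin X x‖ ≤ ‖toEuclideanLin (Ω * X) x‖
  up : ∀ x, ‖toEuclideanLin (Ω * X) x‖ ≤ β * ‖toEuclideanLin X x‖
  sigma : ∀ x, σ * ‖x‖ ≤ ‖toEuclideanLin X x‖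
  normF_le : normF X ≤ F
  sketch_error : 10.5 * (t1 Ω * F) ≤ α * σ
  gram_error : 10.5 * (F * (β + t1 Ω) * √((s + n + 1) * u)) ≤ α * σ
  m_le : (m : ℝ) * u ≤ 1 / 64
  s_le : (s : ℝ) * u ≤ 1 / 64
  n_le : ((n : ℝ) + 1) * u ≤ 1 / 64

namespace SketchBounds

variable (h : SketchBounds Ω X α β σ F)
include h

lemma F_nonneg : 0 ≤ F := (normF_nonneg _).trans h.normF_le

lemma β_pos : 0 < β := h.α_pos.trans_le h.α_le_β

lemma α_mul_le (x : EuclideanSpace ℝ (Fin n)) :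
    α * σ * ‖x‖ ≤ α * ‖toEuclideanLin X x‖ := by
  rw [mul_assoc]
  exact mul_le_mul_of_nonneg_left (h.sigma x) h.α_pos.le

lemma sketch_error_le (x : EuclideanSpace ℝ (Fin n)) :
    10.5 * (t1 Ω * F * ‖x‖) ≤ α * ‖toEuclideanLin X x‖ :=
  le_trans (by linarith [mul_le_mul_of_nonneg_right h.sketch_error (norm_nonneg x)]) (h.α_mul_le x)

/-- The sketching error is at most α‖Xx‖/10.5, and 1 - 1/10.5 > 0.904. -/
lemma norm_sketch_ge (hA : FlMul Ω X A) (x : EuclideanSpace ℝ (Fin n)) :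
    0.904 * (α * ‖toEuclideanLin X x‖) ≤ ‖toEuclideanLin A x‖ := by
  have h1 := hA.norm_sketch_sub_le h.normF_le h.m_le x
  have h2 := norm_sub_norm_le (toEuclideanLin (Ω * X) x) (toEuclideanLin A x)
  rw [norm_sub_rev] at h2
  linarith [h.low x, h.sketch_error_le x, mul_nonneg h.α_pos.le (norm_nonneg (toEuclideanLin X x))]

lemma norm_sketch_le (hA : FlMul Ω X A) (x : EuclideanSpace ℝ (Fin n)) :
    ‖toEuclideanLin A x‖ ≤ 1.0953 * (β * ‖toEuclideanLin X x‖) := by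
  have h1 := hA.norm_sketch_sub_le h.normF_le h.m_le x
  have h2 := norm_sub_norm_le (toEuclideanLin A x) (toEuclideanLin (Ω * X) x)
  have h3 := mul_le_mul_of_nonneg_right h.α_le_β (norm_nonneg (toEuclideanLin X x))
  linarith [h.up x, h.sketch_error_le x, mul_nonneg h.β_pos.le (norm_nonneg (toEuclideanLin X x))]

lemma gram_error_sq (hA : FlMul Ω X A) :
    110.25 * ((s + n + 1) * u * normF A ^ 2) ≤ (α * σ) ^ 2 := by
  have hu := u_pos.le
  have ht := t1_nonneg Ω
  have hF := h.F_nonneg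
  have hβ := h.β_pos.le
  have h1 := pow_le_pow_left₀ (by positivity) h.gram_error 2
  have h2 : 0 ≤ ((s : ℝ) + n + 1) * u := by positivity
  rw [mul_pow, mul_pow, Real.sq_sqrt h2] at h1
  have h3 := pow_le_pow_left₀ (normF_nonneg A)
    (hA.normF_sketch_le h.normF_le h.m_le h.β_pos.le h.up) 2
  have h4 := mul_le_mul_of_nonneg_left h3 h2
  linarith

lemma gram_error_le (hA : FlMul Ω X A) (x : EuclideanSpace ℝ (Fin n)) :
    110.25 * ((s + n + 1) * u * normF A ^ 2 * ‖x‖ ^ 2) ≤ (α * ‖toEuclideanLin X x‖) ^ 2 := by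
  have h1 := mul_le_mul_of_nonneg_right (h.gram_error_sq hA) (sq_nonneg ‖x‖)
  have h2 := pow_le_pow_left₀
    (mul_nonneg (mul_nonneg h.α_pos.le h.σ_pos.le) (norm_nonneg x)) (h.α_mul_le x) 2
  rw [mul_pow] at h2
  linarith

/-- The first pass cannot break down. -/
lemma not_choleskyMayBreakDown (hA : FlMul Ω X A) {G : Matrix (Fin n) (Fin n) ℝ}
    (hG : FlMul Aᵀ A G) : ¬ CholeskyMayBreakDown G := by
  intro hbr
  obtain ⟨x, hx0, hx⟩ := hbr.exists_norm_sq_le hG h.s_le h.n_le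
  have h1 := h.gram_error_le hA x
  have h2 : 0 < α * ‖toEuclideanLin X x‖ :=
    (mul_pos (mul_pos h.α_pos h.σ_pos) (norm_pos_iff.2 hx0)).trans_le (h.α_mul_le x)
  -- Contradiction because 2.4/110.25 < 0.904², where 110.25 = 10.5².
  have h3 := pow_le_pow_left₀ (by positivity) (h.norm_sketch_ge hA x) 2
  nlinarith [pow_pos h2 2]

variable {G Y : Matrix (Fin n) (Fin n) ℝ}

lemma abs_norm_sq_sub_le (hA : FlMul Ω X A) (hG : FlMul Aᵀ A G) (hY : FlCholesky G Y)
    (x : EuclideanSpace ℝ (Fin n)) :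
    |‖toEuclideanLin Y x‖ ^ 2 - ‖toEuclideanLin A x‖ ^ 2| ≤
      0.0097 * (α * ‖toEuclideanLin X x‖) ^ 2 := by
  have h1 := RandCholQR.abs_norm_sq_sub_le A Y x
  have h2 := mul_le_mul_of_nonneg_right (hY.normF_gram_sub_le hG h.s_le h.n_le) (sq_nonneg ‖x‖)
  have h3 := h.gram_error_le hA x
  linarith [sq_nonneg (α * ‖toEuclideanLin X x‖)]

/-- 0.904² - 0.0097 ≥ 0.89²; the companion upper bound rests on 1.0953² + 0.0097 ≤ 1.1². -/
lemma norm_factor_ge (hA : FlMul Ω X A) (hG : FlMul Aᵀ A G) (hY : FlCholesky G Y)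
    (x : EuclideanSpace ℝ (Fin n)) :
    0.89 * (α * ‖toEuclideanLin X x‖) ≤ ‖toEuclideanLin Y x‖ := by
  refine le_of_sq_le_sq ?_ (norm_nonneg _)
  have h0 := mul_nonneg h.α_pos.le (norm_nonneg (toEuclideanLin X x))
  have h1 := (abs_le.1 (h.abs_norm_sq_sub_le hA hG hY x)).1
  have h2 := pow_le_pow_left₀ (by positivity) (h.norm_sketch_ge hA x) 2
  nlinarith [sq_nonneg (α * ‖toEuclideanLin X x‖)]

lemma norm_factor_le (hA : FlMul Ω X A) (hG : FlMul Aᵀ A G) (hY : FlCholesky G Y)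
    (x : EuclideanSpace ℝ (Fin n)) :
    ‖toEuclideanLin Y x‖ ≤ 1.1 * (β * ‖toEuclideanLin X x‖) := by
  have h0 := mul_nonneg h.α_pos.le (norm_nonneg (toEuclideanLin X x))
  have h0' := mul_nonneg h.β_pos.le (norm_nonneg (toEuclideanLin X x))
  refine le_of_sq_le_sq ?_ (by positivity)
  have h1 := (abs_le.1 (h.abs_norm_sq_sub_le hA hG hY x)).2
  have h2 := pow_le_pow_left₀ (norm_nonneg _) (h.norm_sketch_le hA x) 2
  have h3 := pow_le_pow_left₀ h0
    (mul_le_mul_of_nonneg_right h.α_le_β (norm_nonneg (toEuclideanLin X x))) 2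
  nlinarith [sq_nonneg (β * ‖toEuclideanLin X x‖)]

/-- Bounding the spectral norm directly keeps `F` off the main term β‖X‖₂; this produces the factor
√(1+ε) + t₁j in the n² part of `U4`, while `normF_factor_le` produces (√(1+ε) + t₁)j in the other.
-/
lemma norm2_factor_le (hA : FlMul Ω X A) (hG : FlMul Aᵀ A G) (hY : FlCholesky G Y) :
    norm2 Y ≤ 1.01 * (β * norm2 X + t1 Ω * F) := by
  have hq : 0 ≤ β * norm2 X + t1 Ω * F :=
    add_nonneg (mul_nonneg h.β_pos.le (norm2_nonneg _)) (mul_nonneg (t1_nonneg Ω) h.F_nonneg)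
  refine norm2_le _ (by positivity) fun x => ?_
  refine le_of_sq_le_sq ?_ (by positivity)
  have h1 := (abs_le.1 (h.abs_norm_sq_sub_le hA hG hY x)).2
  have hX := norm_toEuclideanLin_le X x
  have h2 : ‖toEuclideanLin A x‖ ≤ (β * norm2 X + t1 Ω * F) * ‖x‖ := by
    have h3 := hA.norm_sketch_sub_le h.normF_le h.m_le x
    have h4 := norm_sub_norm_le (toEuclideanLin A x) (toEuclideanLin (Ω * X) x)
    have h5 := mul_le_mul_of_nonneg_left hX h.β_pos.le
    linarith [h.up x]
  have h3 : α * ‖toEuclideanLin X x‖ ≤ (β * norm2 X + t1 Ω * F) * ‖x‖ := by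
    have h4 := mul_le_mul h.α_le_β hX (norm_nonneg _) h.β_pos.le
    have h5 := mul_nonneg (mul_nonneg (t1_nonneg Ω) h.F_nonneg) (norm_nonneg x)
    linarith
  have h4 := pow_le_pow_left₀ (norm_nonneg _) h2 2
  have h5 := pow_le_pow_left₀ (mul_nonneg h.α_pos.le (norm_nonneg _)) h3 2
  nlinarith [sq_nonneg ((β * norm2 X + t1 Ω * F) * ‖x‖)]

lemma normF_factor_le (hA : FlMul Ω X A) (hG : FlMul Aᵀ A G) (hY : FlCholesky G Y) :
    normF Y ≤ 1.02 * ((β + t1 Ω) * F) :=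
  (hY.normF_le hG h.s_le h.n_le).trans (mul_le_mul_of_nonneg_left
    (hA.normF_sketch_le h.normF_le h.m_le h.β_pos.le h.up) (by norm_num))

lemma n_mul_u_le : (n : ℝ) * u ≤ 1 / 64 := by linarith [h.n_le, u_pos]

variable {W : Matrix (Fin m) (Fin n) ℝ}

/-- The error is n√u · √(nu)(β + t₁)F · ‖W‖₂‖Y⁻¹‖₂ up to a constant. Here n√u ≤ 1/8, the second
factor is at most ασ/10.5 by `gram_error`, and ‖Y⁻¹‖₂ ≤ 1/(0.89ασ) cancels ασ. -/
lemma norm2_solve_error_le (hA : FlMul Ω X A) (hG : FlMul Aᵀ A G) (hY : FlCholesky G Y)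
    (hW : FlTriSolve X Y W) (hn : (n : ℝ) * (n + 1) * u ≤ 1 / 64) :
    norm2 ((W * Y - X) * Y⁻¹) ≤ 0.014 * norm2 W := by
  have hu := u_pos.le
  have hα := h.α_pos
  have hσ := h.σ_pos
  have hy0 : 0 ≤ (β + t1 Ω) * F :=
    mul_nonneg (add_nonneg h.β_pos.le (t1_nonneg Ω)) h.F_nonneg
  have hw0 := norm2_nonneg W
  have hT : norm2 Y⁻¹ ≤ 1 / (0.89 * (α * σ)) := by
    refine norm2_inv_le hY.isUnit_det (by positivity) fun x => ?_
    rw [div_mul_eq_mul_div, one_mul, le_div_iff₀ (by positivity)]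
    linarith [h.norm_factor_ge hA hG hY x, h.α_mul_le x]
  have h1 : normF (W * Y - X) ≤
      64 / 63 * (n * u) * (√n * norm2 W * (1.02 * ((β + t1 Ω) * F))) :=
    (hW.normF_sub_le_of_cholesky hY h.n_mul_u_le).trans (mul_le_mul_of_nonneg_left
      (mul_le_mul (normF_le_sqrt_mul_norm2 W) (h.normF_factor_le hA hG hY) (normF_nonneg _)
        (by positivity)) (by positivity))
  have h2 : n * √u ≤ 1 / 8 := by
    refine le_of_sq_le_sq ?_ (by norm_num)
    rw [mul_pow, Real.sq_sqrt hu]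
    nlinarith [mul_nonneg (Nat.cast_nonneg (α := ℝ) n) hu]
  have h3 : √n * √u * ((β + t1 Ω) * F) ≤ α * σ / 10.5 := by
    have h4 : √n * √u ≤ √((s + n + 1) * u) := by
      rw [← Real.sqrt_mul (Nat.cast_nonneg n)]
      refine Real.sqrt_le_sqrt (mul_le_mul_of_nonneg_right ?_ hu)
      linarith [Nat.cast_nonneg (α := ℝ) s]
    have h5 := mul_le_mul_of_nonneg_right h4 hy0
    rw [le_div_iff₀ (by norm_num)]
    linarith [h.gram_error]
  have h4 : n * u * √n * ((β + t1 Ω) * F) ≤ 1 / 8 * (α * σ / 10.5) := by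
    have h5 := mul_le_mul h2 h3 (by positivity) (by norm_num)
    have h6 : n * √u * (√n * √u * ((β + t1 Ω) * F)) = n * u * √n * ((β + t1 Ω) * F) := by
      linear_combination (n * √n * ((β + t1 Ω) * F)) * Real.mul_self_sqrt hu
    linarith
  calc norm2 ((W * Y - X) * Y⁻¹) ≤ norm2 (W * Y - X) * norm2 Y⁻¹ := norm2_mul_le _ _
    _ ≤ (64 / 63 * (n * u) * (√n * norm2 W * (1.02 * ((β + t1 Ω) * F)))) *
          (1 / (0.89 * (α * σ))) :=
        mul_le_mul ((norm2_le_normF _).trans h1) hT (norm2_nonneg _) (by positivity)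
    _ = 64 / 63 * 1.02 * norm2 W * (1 / (0.89 * (α * σ))) *
          (n * u * √n * ((β + t1 Ω) * F)) := by ring
    _ ≤ 64 / 63 * 1.02 * norm2 W * (1 / (0.89 * (α * σ))) * (1 / 8 * (α * σ / 10.5)) :=
        mul_le_mul_of_nonneg_left h4 (by positivity)
    _ = (64 / 63 * 1.02 / (0.89 * 8 * 10.5)) * norm2 W := by field_simp
    _ ≤ _ := mul_le_mul_of_nonneg_right (by norm_num) hw0

/-- The error relative to ‖W‖₂ is absorbed on the left: 1/(0.89·0.986) ≤ 1.14. -/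
lemma norm2_solve_le (hA : FlMul Ω X A) (hG : FlMul Aᵀ A G) (hY : FlCholesky G Y)
    (hW : FlTriSolve X Y W) (hn : (n : ℝ) * (n + 1) * u ≤ 1 / 64) : norm2 W ≤ 1.14 / α := by
  have hα := h.α_pos
  have h1 : norm2 (X * Y⁻¹) ≤ 1 / (0.89 * α) := by
    refine norm2_mul_inv_le X hY.isUnit_det (by positivity) fun x => ?_
    rw [div_mul_eq_mul_div, one_mul, le_div_iff₀ (by positivity)]
    linarith [h.norm_factor_ge hA hG hY x]
  have h2 := h.norm2_solve_error_le hA hG hY hW hn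
  have h3 : norm2 W ≤ norm2 (X * Y⁻¹) + norm2 ((W * Y - X) * Y⁻¹) := by
    refine norm2_le _ (add_nonneg (norm2_nonneg _) (norm2_nonneg _)) fun x => ?_
    have h4 : toEuclideanLin W x =
        toEuclideanLin (X * Y⁻¹) x + toEuclideanLin ((W * Y - X) * Y⁻¹) x := by
      rw [← LinearMap.add_apply, ← map_add, ← hY.eq_add_solve_error X W]
    rw [h4, add_mul]
    exact (norm_add_le _ _).trans
      (add_le_add (norm_toEuclideanLin_le _ _) (norm_toEuclideanLin_le _ _))
  have h4 : 1 / (0.89 * α) = (1 / 0.89) * α⁻¹ := by field_simp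
  have h5 : 0 < α⁻¹ := by positivity
  rw [h4] at h1
  rw [div_eq_mul_inv]
  linarith

/-- XY⁻¹ expands by at least 1/(1.1β) ≥ 0.87/β, and the solve error costs at most 0.014·1.14/α ≤
0.02/α. -/
lemma norm_solve_ge (hA : FlMul Ω X A) (hG : FlMul Aᵀ A G) (hY : FlCholesky G Y)
    (hW : FlTriSolve X Y W) (hn : (n : ℝ) * (n + 1) * u ≤ 1 / 64)
    (x : EuclideanSpace ℝ (Fin n)) :
    (0.87 / β - 0.02 / α) * ‖x‖ ≤ ‖toEuclideanLin W x‖ := by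
  have hα := h.α_pos
  have hβ := h.β_pos
  have h1 : 1 / (1.1 * β) * ‖x‖ ≤ ‖toEuclideanLin (X * Y⁻¹) x‖ := by
    have h2 := h.norm_factor_le hA hG hY (toEuclideanLin Y⁻¹ x)
    rw [← toEuclideanLin_mul, ← toEuclideanLin_mul, mul_nonsing_inv _ hY.isUnit_det] at h2
    have h3 : toEuclideanLin (1 : Matrix (Fin n) (Fin n) ℝ) x = x := by simp
    rw [h3] at h2
    rw [div_mul_eq_mul_div, one_mul, div_le_iff₀ (by positivity)]
    linarith
  have h2 : ‖toEuclideanLin ((W * Y - X) * Y⁻¹) x‖ ≤ 0.02 / α * ‖x‖ := by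
    refine (norm_toEuclideanLin_le _ x).trans (mul_le_mul_of_nonneg_right ?_ (norm_nonneg x))
    have h3 := h.norm2_solve_error_le hA hG hY hW hn
    have h4 := h.norm2_solve_le hA hG hY hW hn
    have h5 : 0 < α⁻¹ := by positivity
    rw [div_eq_mul_inv] at h4 ⊢
    linarith
  have h4 : toEuclideanLin W x =
      toEuclideanLin (X * Y⁻¹) x + toEuclideanLin ((W * Y - X) * Y⁻¹) x := by
    rw [← LinearMap.add_apply, ← map_add, ← hY.eq_add_solve_error X W]
  have h5 := norm_sub_norm_le (toEuclideanLin (X * Y⁻¹) x)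
    (-toEuclideanLin ((W * Y - X) * Y⁻¹) x)
  rw [sub_neg_eq_add, ← h4, norm_neg] at h5
  have h6 : 0.87 / β * ‖x‖ ≤ 1 / (1.1 * β) * ‖x‖ := by
    refine mul_le_mul_of_nonneg_right ?_ (norm_nonneg x)
    rw [div_le_div_iff₀ hβ (by positivity)]
    linarith
  rw [sub_mul]
  linarith

end SketchBounds

end FirstPass

/-! ### The constant b, the condition on κ₂(X), the residual and the final statement. -/

section Assembly

lemma IsSubspaceEmbedding.norm_bounds {s m : ℕ} {ε : ℝ} {Ω : Matrix (Fin s) (Fin m) ℝ}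
    {K : Submodule ℝ (EuclideanSpace ℝ (Fin m))} (h : IsSubspaceEmbedding ε Ω K)
    {y : EuclideanSpace ℝ (Fin m)} (hy : y ∈ K) :
    √(1 - ε) * ‖y‖ ≤ ‖toEuclideanLin Ω y‖ ∧ ‖toEuclideanLin Ω y‖ ≤ √(1 + ε) * ‖y‖ := by
  have h1 := h.2 y hy y hy
  rw [real_inner_self_eq_norm_sq, real_inner_self_eq_norm_sq, mul_assoc, ← sq, abs_le] at h1
  have h2 := h.1
  constructor
  · refine le_of_sq_le_sq ?_ (norm_nonneg _)
    rw [mul_pow, Real.sq_sqrt (by linarith)]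
    linarith
  · refine le_of_sq_le_sq ?_ (mul_nonneg (Real.sqrt_nonneg _) (norm_nonneg _))
    rw [mul_pow, Real.sq_sqrt (by linarith)]
    linarith

/-- The numerical properties of the constant `b`. -/
lemma bConst_bounds {η ε : ℝ} (hη : 0 < η) (hε0 : 0 ≤ ε) (hε1 : ε < 1)
    (h : 32 / 3 * √η + 2 / 87 ≤ √(1 - ε) / √(1 + ε)) :
    1 ≤ bConst ε ∧ bConst ε ^ 2 * η ≤ 1 / 64 ∧
      0 < 0.87 / √(1 + ε) - 0.02 / √(1 - ε) ∧
      bConst ε * (0.87 / √(1 + ε) - 0.02 / √(1 - ε)) = 1.16 / √(1 - ε) := by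
  have hα : 0 < √(1 - ε) := Real.sqrt_pos.2 (by linarith)
  have hβ : 0 < √(1 + ε) := Real.sqrt_pos.2 (by linarith)
  have hαβ : √(1 - ε) ≤ √(1 + ε) := Real.sqrt_le_sqrt (by linarith)
  rw [bConst, Real.sqrt_div (by linarith : 0 ≤ 1 - ε)]
  set D := 0.87 * (√(1 - ε) / √(1 + ε)) - 0.02 with hD
  -- The hypothesis is fitted to this: 0.87·(32/3) = 9.28 and 0.87·(2/87) = 0.02. As 1.16/9.28 =
  -- 1/8, it follows that b²η ≤ 1/64.
  have hDη : 9.28 * √η ≤ D := by linarith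
  have hη' : 0 < √η := Real.sqrt_pos.2 hη
  have hD0 : 0 < D := by linarith
  have hD1 : D ≤ 0.87 := by
    have := (div_le_one hβ).2 hαβ
    linarith
  have hω : 0.87 / √(1 + ε) - 0.02 / √(1 - ε) = D / √(1 - ε) := by
    rw [hD]
    field_simp
  refine ⟨(one_le_div hD0).2 (by linarith), ?_, ?_, ?_⟩
  · rw [div_pow, div_mul_eq_mul_div, div_le_iff₀ (by positivity)]
    have := pow_le_pow_left₀ (by positivity) hDη 2
    rw [mul_pow, Real.sq_sqrt hη.le] at this
    linarith
  · rw [hω]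
    positivity
  · rw [hω]
    field_simp

variable {s m n : ℕ} {Ω : Matrix (Fin s) (Fin m) ℝ} {X : Matrix (Fin m) (Fin n) ℝ}

lemma jRatio_mul_norm2 (hX : 0 < norm2 X) : jRatio X * norm2 X = normG X :=
  div_mul_cancel₀ _ hX.ne'

/-- The condition `κ₂(X) ≤ w₁` in terms of the smallest singular value. -/
lemma bounds_of_cond2_le_w1 {ε : ℝ} (hε0 : 0 ≤ ε) (hε1 : ε < 1) (hσ : 0 < sigmaMin X)
    (hX : 0 < norm2 X) (h : cond2 X ≤ w1 ε Ω X) :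
    10.5 * (t1 Ω * normG X) ≤ √(1 - ε) * sigmaMin X ∧
      10.5 * (normG X * (√(1 + ε) + t1 Ω) * √((s + n + 1) * u)) ≤ √(1 - ε) * sigmaMin X := by
  have hu := u_pos
  have hα : 0 < √(1 - ε) := Real.sqrt_pos.2 (by linarith)
  have hβ : 0 < √(1 + ε) := Real.sqrt_pos.2 (by linarith)
  have ht := t1_nonneg Ω
  have hG : 0 < normG X := hX.trans_le ((norm2_le_normF X).trans (normF_le_normG X))
  have hJ : 0 < jRatio X := div_pos hG hX
  have hJX := jRatio_mul_norm2 hX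
  obtain ⟨h1, h2⟩ := le_min_iff.1 h
  rw [cond2] at h1 h2
  constructor
  · rcases ht.eq_or_lt with h0 | h0
    · rw [← h0]
      have := mul_pos hα hσ
      simpa using this.le
    · rw [div_le_div_iff₀ hσ (by positivity)] at h1
      rw [← hJX]
      linarith
  · have hsn : (s : ℝ) * u + (n + 1) * u = (s + n + 1) * u := by ring
    have hpos : 0 < ((s : ℝ) + n + 1) * u := by positivity
    have hr := Real.sqrt_pos.2 hpos
    rw [hsn, Real.sqrt_div (by linarith : 0 ≤ 1 - ε), div_mul_div_comm, one_mul,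
      div_le_div_iff₀ hσ (by positivity)] at h2
    rw [← hJX]
    linarith

/-- Bound for the residual in terms of the norms of the factors. -/
lemma normF_residual_le {Q W : Matrix (Fin m) (Fin n) ℝ} {G C Y Z R : Matrix (Fin n) (Fin n) ℝ}
    {α H y z : ℝ} (hα : 0 < α) (hy : 0 ≤ y) (hn : (n : ℝ) * u ≤ 1 / 64)
    (hW : norm2 W ≤ 1.14 / α) (hYF : normF Y ≤ 1.02 * y) (hY2 : norm2 Y ≤ 1.01 * z)
    (hQ : norm2 Q ≤ H) (hZF : normF Z ≤ 1.02 * normF W) (hY : FlCholesky G Y)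
    (hZ : FlCholesky C Z) (hsW : FlTriSolve X Y W) (hsQ : FlTriSolve W Z Q) (hR : FlMul Z Y R) :
    normF (Q * R - X) ≤ (1.32 + 1.34 * H) * (n * √n * u * y / α) +
      1.34 * H * ((n : ℝ) ^ 2 * u * z / α) := by
  have hu := u_pos.le
  have hsn := Real.sq_sqrt (Nat.cast_nonneg (α := ℝ) n)
  have hH : 0 ≤ H := (norm2_nonneg Q).trans hQ
  have hz : 0 ≤ z := by linarith [norm2_nonneg Y]
  have hWF : normF W ≤ √n * (1.14 / α) := (normF_le_sqrt_mul_norm2 W).trans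
    (mul_le_mul_of_nonneg_left hW (Real.sqrt_nonneg _))
  have hQF : normF Q ≤ √n * H := (normF_le_sqrt_mul_norm2 Q).trans
    (mul_le_mul_of_nonneg_left hQ (Real.sqrt_nonneg _))
  have hZF' : normF Z ≤ 1.02 * (√n * (1.14 / α)) :=
    hZF.trans (mul_le_mul_of_nonneg_left hWF (by norm_num))
  have hg : 0 ≤ 64 / 63 * ((n : ℝ) * u) := by positivity
  have e1 : normF (W * Y - X) ≤ 64 / 63 * (n * u) * (√n * (1.14 / α) * (1.02 * y)) :=
    (hsW.normF_sub_le_of_cholesky hY hn).trans (mul_le_mul_of_nonneg_left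
      (mul_le_mul hWF hYF (normF_nonneg _) (by positivity)) hg)
  have e2 : normF ((Q * Z - W) * Y) ≤
      64 / 63 * (n * u) * (√n * H * (1.02 * (√n * (1.14 / α)))) * (1.01 * z) :=
    (normF_mul_le_mul_norm2 _ _).trans (mul_le_mul
      ((hsQ.normF_sub_le_of_cholesky hZ hn).trans (mul_le_mul_of_nonneg_left
        (mul_le_mul hQF hZF' (normF_nonneg _) (by positivity)) hg))
      hY2 (norm2_nonneg _) (by positivity))
  have e3 : normF (Q * (R - Z * Y)) ≤
      H * (64 / 63 * (n * u) * (1.02 * (√n * (1.14 / α)) * (1.02 * y))) :=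
    (normF_mul_le_norm2_mul _ _).trans (mul_le_mul hQ
      (hR.normF_sub_le.trans (mul_le_mul (flGrowth_pow_sub_one_le hn)
        (mul_le_mul hZF' hYF (normF_nonneg _) (by positivity))
        (mul_nonneg (normF_nonneg _) (normF_nonneg _)) hg)) (normF_nonneg _) hH)
  -- Errors of the first solve, of the second solve and of the product ZY. The second meets √n
  -- twice, through ‖Q‖_F and ‖W‖_F, and so gives the n² term.
  have hsplit : Q * R - X = (W * Y - X) + ((Q * Z - W) * Y + Q * (R - Z * Y)) := by
    rw [Matrix.sub_mul, Matrix.mul_sub, Matrix.mul_assoc]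
    abel
  rw [hsplit]
  refine (normF_add_le _ _).trans ?_
  have h2 := normF_add_le ((Q * Z - W) * Y) (Q * (R - Z * Y))
  have p1 : 0 ≤ n * √n * u * y / α := by positivity
  have p2 : 0 ≤ (n : ℝ) ^ 2 * u * z / α := by positivity
  have q1 : 64 / 63 * (n * u) * (√n * (1.14 / α) * (1.02 * y)) =
      64 / 63 * 1.14 * 1.02 * (n * √n * u * y / α) := by ring
  have q2 : 64 / 63 * (n * u) * (√n * H * (1.02 * (√n * (1.14 / α)))) * (1.01 * z) =
      64 / 63 * 1.02 * 1.14 * 1.01 * (H * ((n : ℝ) ^ 2 * u * z / α)) := by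
    have : 64 / 63 * (n * u) * (√n * H * (1.02 * (√n * (1.14 / α)))) * (1.01 * z) =
      64 / 63 * 1.02 * 1.14 * 1.01 * (H * (n * (√n ^ 2) * u * z / α)) := by ring
    rw [this, hsn]
    ring
  have q3 : H * (64 / 63 * (n * u) * (1.02 * (√n * (1.14 / α)) * (1.02 * y))) =
      64 / 63 * 1.02 * 1.14 * 1.02 * (H * (n * √n * u * y / α)) := by ring
  rw [q1] at e1
  rw [q2] at e2
  rw [q3] at e3
  linarith [mul_nonneg hH p1, mul_nonneg hH p2]

/-- The deterministic part: SRCholeskyQR2 with a sketch that embeds the range of `X`. -/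
theorem srCholeskyQR2_of_isSubspaceEmbedding (hn : 1 ≤ n) (hsm : s ≤ m) (hX : X.rank = n) {ε : ℝ}
    (hΩ : IsSubspaceEmbedding ε Ω (toEuclideanLin X).range)
    (hmn : (m : ℝ) * n * u ≤ 1 / 64) (hnn : (n : ℝ) * (n + 1) * u ≤ 1 / 64)
    (hε : 32 / 3 * √(m * n * u + n * (n + 1) * u) + 2 / 87 ≤ √(1 - ε) / √(1 + ε))
    (hcond : cond2 X ≤ w1 ε Ω X) :
    ¬ SRCholeskyQR2MayBreakDown Ω X ∧
      ∀ (Q : Matrix (Fin m) (Fin n) ℝ) (R : Matrix (Fin n) (Fin n) ℝ),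
        FlSRCholeskyQR2 Ω X Q R →
          normF (Qᵀ * Q - 1) ≤ 5 * bConst ε ^ 2 * (m * n * u + n * (n + 1) * u) ∧
          normF (Q * R - X) ≤ U4 ε Ω X := by
  obtain ⟨hε0, hε1⟩ := hΩ.1
  have hu := u_pos
  have hn' : (1 : ℝ) ≤ n := by exact_mod_cast hn
  have hσ := sigmaMin_pos X hn hX
  have hN : 0 < norm2 X := by
    have h1 := sigmaMin_mul_norm_le X hn (EuclideanSpace.single ⟨0, hn⟩ 1)
    have h2 := norm_toEuclideanLin_le X (EuclideanSpace.single ⟨0, hn⟩ 1)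
    simp only [PiLp.norm_single, norm_one, mul_one] at h1 h2
    linarith
  obtain ⟨hc1, hc2⟩ := bounds_of_cond2_le_w1 hε0 hε1 hσ hN hcond
  have hmu : 0 ≤ (m : ℝ) * u := by positivity
  have hm : (m : ℝ) * u ≤ 1 / 64 := by nlinarith
  have hnu : ((n : ℝ) + 1) * u ≤ 1 / 64 := by nlinarith [show 0 ≤ ((n : ℝ) + 1) * u by positivity]
  have hs : (s : ℝ) * u ≤ 1 / 64 :=
    (mul_le_mul_of_nonneg_right (by exact_mod_cast hsm) hu.le).trans hm
  have S : SketchBounds Ω X √(1 - ε) √(1 + ε) (sigmaMin X) (normG X) :=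
    { α_pos := Real.sqrt_pos.2 (by linarith)
      α_le_β := Real.sqrt_le_sqrt (by linarith)
      σ_pos := hσ
      low := fun x => by
        rw [toEuclideanLin_mul]
        exact (hΩ.norm_bounds (LinearMap.mem_range_self _ x)).1
      up := fun x => by
        rw [toEuclideanLin_mul]
        exact (hΩ.norm_bounds (LinearMap.mem_range_self _ x)).2
      sigma := sigmaMin_mul_norm_le X hn
      normF_le := normF_le_normG X
      sketch_error := hc1
      gram_error := hc2
      m_le := hm
      s_le := hs
      n_le := hnu }
  obtain ⟨hb1, hbη, hω, hbω⟩ := bConst_bounds (by positivity) hε0 hε1 hε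
  have hWb : ∀ {W : Matrix (Fin m) (Fin n) ℝ}, norm2 W ≤ 1.14 / √(1 - ε) →
      norm2 W ≤ bConst ε * (0.87 / √(1 + ε) - 0.02 / √(1 - ε)) := fun h => by
    rw [hbω]
    exact h.trans (div_le_div_of_nonneg_right (by norm_num) S.α_pos.le)
  refine ⟨?_, ?_⟩
  · rintro (⟨A, G, hA, hG, hbr⟩ | ⟨W, Y, C, ⟨A, G, hA, hG, hY, hW⟩, hC, hbr⟩)
    · exact S.not_choleskyMayBreakDown hA hG hbr
    · exact not_choleskyMayBreakDown_of_wellConditioned hω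
        (hWb (S.norm2_solve_le hA hG hY hW hnn)) (S.norm_solve_ge hA hG hY hW hnn) hbη hm hnu hC hbr
  · rintro Q R ⟨W, Y, Z, ⟨A, G, hA, hG, hY, hW⟩, ⟨C, hC, hZ, hQ⟩, hR⟩
    have hW2 := S.norm2_solve_le hA hG hY hW hnn
    have horth := hZ.normF_gram_sub_one_le hω hb1 (hWb hW2) (S.norm_solve_ge hA hG hY hW hnn)
      hbη hm hnu hC hQ
    refine ⟨horth, ?_⟩
    have hres := normF_residual_le (R := R) S.α_pos
      (mul_nonneg (add_nonneg S.β_pos.le (t1_nonneg Ω)) S.F_nonneg) S.n_mul_u_le hW2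
      (S.normF_factor_le hA hG hY) (S.norm2_factor_le hA hG hY) (norm2_le_of_gram horth)
      (hZ.normF_le hC hm hnu) hY hZ hW hQ hR
    refine hres.trans_eq ?_
    rw [U4, hConst, ← jRatio_mul_norm2 hN]
    ring

end Assembly

end RandCholQR

theorem theorem3p4 {Θ : Type*} [MeasurableSpace Θ] (P : Measure Θ) [IsProbabilityMeasure P]
    (m n s : ℕ) (hn : 1 ≤ n) (hns : n ≤ s) (hsm : s ≤ m)
    (g : ℝ) (hg : 1 ≤ g) (hm : g * n ≤ m)
    (X : Matrix (Fin m) (Fin n) ℝ) (hX : X.rank = n)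
    (ε p : ℝ) (hε0 : 0 ≤ ε) (hε1 : ε < 1)
    (Ω : Θ → Matrix (Fin s) (Fin m) ℝ) (hΩmeas : ∀ i j, Measurable fun θ => Ω θ i j)
    (hΩ : IsObliviousSubspaceEmbedding P Ω ε p n)
    (h31 : (m : ℝ) * n * u ≤ 1 / 64)
    (h32 : (n : ℝ) * (n + 1) * u ≤ 1 / 64)
    (ha51 : 32 / 3 * √(m * n * u + n * (n + 1) * u) + 2 / 87 ≤ √(1 - ε) / √(1 + ε)) :
    HoldsWithProb P (1 - p) (fun θ =>
      cond2 X ≤ w1 ε (Ω θ) X →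
        ¬ SRCholeskyQR2MayBreakDown (Ω θ) X ∧
        ∀ (Q : Matrix (Fin m) (Fin n) ℝ) (R : Matrix (Fin n) (Fin n) ℝ),
          FlSRCholeskyQR2 (Ω θ) X Q R →
            normF (Q.transpose * Q - 1) ≤ 5 * bConst ε ^ 2 * (m * n * u + n * (n + 1) * u) ∧
            normF (Q * R - X) ≤ U4 ε (Ω θ) X) := by
  -- The subspace depends on X alone, so the oblivious property applies to it.
  obtain ⟨S, hS, hE, hP⟩ := hΩ (Matrix.toEuclideanLin X).range
    (by rw [finrank_range_toEuclideanLin, hX])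
  exact ⟨S, hS, fun θ hθ hcond =>
    srCholeskyQR2_of_isSubspaceEmbedding hn hsm hX (hE θ hθ) h31 h32 ha51 hcond, hP⟩
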